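/- Let $Q=[-1,1]^2$, let $\varphi_k(t)=\sqrt{k+1/2}\,(2^kk!)^{-1}\frac{d^k}{dt^k}(t^2-1)^k$, $k\ge 0$, be the Legendre polynomials orthonormal on $[-1,1]$, and put $\langle f,\varphi_{k,j}\rangle=\int_{-1}^1\int_{-1}^1 f(t,\tau)\varphi_k(t)\varphi_j(\tau)\,d\tau\,dt$. For $1\le s<\infty$ and $\mu=(\mu_1,\mu_2)$ let $L^{\mu}_{s,2}$ be the class of all $f\in L_2(Q)$ with $$\|f\|_{s,\mu}=\Big(\sum_{k,j\ge 0}\max(1,k)^{s\mu_1}\max(1,j)^{s\mu_2}|\langle f,\varphi_{k,j}\rangle|^s\Big)^{1/s}\le 1 .$$ For an integer $r\ge 1$ put $f^{(r,0)}(t,\tau)=\sum_{k\ge r}\sum_{j\ge 0}\langle f,\varphi_{k,j}\rangle\varphi_k^{(r)}(t)\varphi_j(\tau)$. For $0<\delta<1$ and $1\le p\le\infty$, a $\delta$-perturbation of $f$ is a real sequence $a=(a_{k,j})_{k,j\ge 0}$ with $\|(\langle f,\varphi_{k,j}\rangle-a_{k,j})_{k,j}\|_{\ell_p}\le\delta$.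 For a finite set $\Omega$ of integer points $(k,j)$ with $k\ge r$, $j\ge 0$, an algorithm is any map $\psi:\mathbb R^{\Omega}\to C(Q)$; its error is $$\varepsilon_\delta(\psi)=\sup_{f\in L^{\mu}_{s,2}}\ \sup_{a}\ \|f^{(r,0)}-\psi((a_{k,j})_{(k,j)\in\Omega})\|_{C(Q)},$$ where $a$ runs over the $\delta$-perturbations of $f$. The minimal radius of Galerkin information is $$R_{N,\delta}=R^{(r,0)}_{N,\delta}(L^{\mu}_{s,2},C,\ell_p)=\inf_{\mathrm{card}\,\Omega\le N}\ \inf_{\psi:\mathbb R^\Omega\to C(Q)}\varepsilon_\delta(\psi).$$ For integers $n\ge r$ and real $\gamma\ge 1$ let $\Gamma_{n,\gamma}=\{(k,j): kj^\gamma\le n,\ r\le k\le n,\ 0\le j\le (n/r)^{1/\gamma}\}$, and let $\mathcal D_{n,\gamma}$ be the truncation method $a\mapsto\sum_{(k,j)\in\Gamma_{n,\gamma}}a_{k,j}\varphi_k^{(r)}(t)\varphi_j(\tau)$. Assume $1\le s<\infty$, $r\ge 1$, $\mu_1>2r-1/s+3/2$, $\mu_2>\mu_1-2r$, $1\le p\le\infty$,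 and put $\alpha=\mu_1-2r+1/s-3/2$, $\beta=\mu_1-1/p+1/s$ (both are positive). Below, $x\asymp y$ means $c_1y\le x\le c_2y$ and $x\preceq y$ means $x\le c\,y$ with positive constants; the constants in the conclusions do not depend on $\delta$, $N$, $n$; they may depend on $r,s,\mu_1,\mu_2,p$, on $\gamma$ where it occurs, and on the constants in the hypotheses $N\asymp\dots$, $n\asymp\dots$. Then for every $f\in L^{\mu}_{s,2}$ the series for $f^{(r,0)}$ converges unconditionally in $C(Q)$, and the following holds. (a) If $0<\delta<1$ and $N\asymp\delta^{-1/\beta}$, then $R_{N,\delta}\asymp N^{-\alpha}\asymp\delta^{\alpha/\beta}$. This order is attained by $\mathcal D_{n,\gamma}$ with $n\asymp\delta^{-1/\beta}$ and $1<\gamma<\dfrac{\mu_2+1/s-3/2}{\mu_1-2r+1/s-3/2}$: for all such $n\ge r$ one has $\mathrm{card}\,\Gamma_{n,\gamma}\asymp\delta^{-1/\beta}$ and $\varepsilon_\delta(\mathcal D_{n,\gamma})\asymp\delta^{\alpha/\beta}$; and if $\delta$ is small enough and $N\asymp\delta^{-1/\beta}$, there is an $n\ge r$ with $n\asymp\delta^{-1/\beta}$,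 $\mathrm{card}\,\Gamma_{n,\gamma}\le N$ and $\varepsilon_\delta(\mathcal D_{n,\gamma})\preceq N^{-\alpha}$. (b) If $0<\delta<1$ and $N\asymp\delta^{-1/\beta}\ln\frac1\delta$, then $N^{-\alpha}\preceq R_{N,\delta}$, and, if $N\ge 2$, $R_{N,\delta}\preceq(N/\ln N)^{-\alpha}$; moreover $$\delta^{\alpha/\beta}\Big(\ln\frac1\delta\Big)^{-\alpha}\preceq R_{N,\delta}\preceq\delta^{\alpha/\beta}.$$ The upper bounds are attained by $\mathcal D_{n,1}$ with $n\asymp\delta^{-1/\beta}$: for all such $n\ge r$ one has $\varepsilon_\delta(\mathcal D_{n,1})\preceq\delta^{\alpha/\beta}$ and, if $\delta$ is small enough, $\mathrm{card}\,\Gamma_{n,1}\asymp\delta^{-1/\beta}\ln\frac1\delta$; and if $\delta$ is small enough and $N\asymp\delta^{-1/\beta}\ln\frac1\delta$, there is an $n\ge r$ with $n\asymp\delta^{-1/\beta}$, $\mathrm{card}\,\Gamma_{n,1}\le N$, $\varepsilon_\delta(\mathcal D_{n,1})\preceq(N/\ln N)^{-\alpha}$ and $\varepsilon_\delta(\mathcal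 D_{n,1})\preceq\delta^{\alpha/\beta}$. -/

import Mathlib

open Set MeasureTheory
open scoped ENNReal

namespace GalerkinRadius

/-- The square `Q = [-1,1]²`. -/
def square : Set (ℝ × ℝ) := Icc (-1 : ℝ) 1 ×ˢ Icc (-1 : ℝ) 1

instance : CompactSpace square :=
  isCompact_iff_compactSpace.mp (isCompact_Icc.prod isCompact_Icc)

/-- The Legendre polynomial `φ_k`, orthonormal on `[-1,1]`, by Rodrigues' formula. -/
noncomputable def legendre (k : ℕ) : Polynomial ℝ :=
  Polynomial.C (Real.sqrt ((k : ℝ) + 1 / 2) * ((2 : ℝ) ^ k * (k.factorial : ℝ))⁻¹) *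
    Polynomial.derivative^[k] ((Polynomial.X ^ 2 - 1) ^ k)

/-- The Fourier-Legendre coefficient `⟨f, φ_{k,j}⟩`, where `i = (k, j)`. -/
noncomputable def coeff (f : ℝ × ℝ → ℝ) (i : ℕ × ℕ) : ℝ :=
  ∫ t in (-1 : ℝ)..1, ∫ τ in (-1 : ℝ)..1,
    f (t, τ) * (legendre i.1).eval t * (legendre i.2).eval τ

/-- The summand `max(1,k)^{s μ₁} max(1,j)^{s μ₂} |⟨f, φ_{k,j}⟩|^s` of `‖f‖_{s,μ}^s`. -/
noncomputable def normTerm (s μ₁ μ₂ : ℝ) (f : ℝ × ℝ → ℝ) (i : ℕ × ℕ) : ℝ :=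
  ((max 1 i.1 : ℕ) : ℝ) ^ (s * μ₁) * ((max 1 i.2 : ℕ) : ℝ) ^ (s * μ₂) * |coeff f i| ^ s

/-- The class `L^μ_{s,2}`: the unit ball of the space of all `f ∈ L₂(Q)` with `‖f‖_{s,μ} < ∞`. -/
def unitBall (s μ₁ μ₂ : ℝ) : Set (ℝ × ℝ → ℝ) :=
  {f | MemLp f 2 (volume.restrict square) ∧ Summable (normTerm s μ₁ μ₂ f) ∧
    (∑' i, normTerm s μ₁ μ₂ f i) ^ (1 / s) ≤ 1}

/-- The function `φ_k^{(r)}(t) φ_j(τ)` in `C(Q)`, where `i = (k, j)`. -/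
noncomputable def basisDeriv (r : ℕ) (i : ℕ × ℕ) : C(square, ℝ) where
  toFun x := (Polynomial.derivative^[r] (legendre i.1)).eval x.1.1 * (legendre i.2).eval x.1.2
  continuous_toFun := by fun_prop

/-- The terms of the series for `f^{(r,0)}`; its summation range `k ≥ r`, `j ≥ 0` is indexed by
`m = (k - r, j)`. -/
noncomputable def derivTerm (r : ℕ) (f : ℝ × ℝ → ℝ) (m : ℕ × ℕ) : C(square, ℝ) :=
  coeff f (r + m.1, m.2) • basisDeriv r (r + m.1, m.2)

/-- The partial derivative `f^{(r,0)}`, as the sum of its series in `C(Q)`. -/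
noncomputable def partialDeriv (r : ℕ) (f : ℝ × ℝ → ℝ) : C(square, ℝ) :=
  ∑' m, derivTerm r f m

/-- `‖c - a‖_{ℓ_p} ≤ δ` for the exact coefficients `c` and the perturbed ones `a`. -/
def IsPerturbation (p : ℝ≥0∞) (δ : ℝ) (c a : ℕ × ℕ → ℝ) : Prop :=
  ∃ h : Memℓp (fun i => c i - a i) p,
    ‖(⟨fun i => c i - a i, h⟩ : lp (fun _ : ℕ × ℕ => ℝ) p)‖ ≤ δ

/-- The error on the class `L^μ_{s,2}`, in the metric of `C(Q)` and under `δ`-perturbations in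
`ℓ_p`, of an arbitrary algorithm `ψ` that uses the coefficients with indices in `Ω`. -/
noncomputable def algError (r : ℕ) (s μ₁ μ₂ : ℝ) (p : ℝ≥0∞) (δ : ℝ) (Ω : Finset (ℕ × ℕ))
    (ψ : (Ω → ℝ) → C(square, ℝ)) : ℝ≥0∞ :=
  ⨆ f ∈ unitBall s μ₁ μ₂, ⨆ (a : ℕ × ℕ → ℝ) (_ : IsPerturbation p δ (coeff f) a),
    ‖partialDeriv r f - ψ (fun i => a i)‖ₑ

/-- The minimal radius `R^{(r,0)}_{N,δ}(L^μ_{s,2}, C, ℓ_p)` of the Galerkin information. -/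
noncomputable def minRadius (r : ℕ) (s μ₁ μ₂ : ℝ) (p : ℝ≥0∞) (δ : ℝ) (N : ℕ) : ℝ≥0∞ :=
  ⨅ (Ω : Finset (ℕ × ℕ)) (_ : (∀ i ∈ Ω, r ≤ i.1) ∧ Ω.card ≤ N) (ψ : (Ω → ℝ) → C(square, ℝ)),
    algError r s μ₁ μ₂ p δ Ω ψ

/-- The truncation method on the index set `Ω`. -/
noncomputable def truncation (r : ℕ) (Ω : Finset (ℕ × ℕ)) (v : Ω → ℝ) : C(square, ℝ) :=
  ∑ i : Ω, v i • basisDeriv r i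

open Classical in
/-- The hyperbolic cross `Γ_{n,γ}` of all `(k, j)` with `k j^γ ≤ n`, `r ≤ k ≤ n` and
`0 ≤ j ≤ (n/r)^{1/γ}`. -/
noncomputable def hyperbolicCross (r n : ℕ) (γ : ℝ) : Finset (ℕ × ℕ) :=
  (Finset.Icc r n ×ˢ Finset.Icc 0 ⌊((n : ℝ) / r) ^ (1 / γ)⌋₊).filter
    (fun i => (i.1 : ℝ) * (i.2 : ℝ) ^ γ ≤ n)

/-- The error of the hyperbolic-cross truncation method `D^{(r,0)}_{n,γ}`. -/
noncomputable def crossError (r : ℕ) (s μ₁ μ₂ : ℝ) (p : ℝ≥0∞) (δ : ℝ) (n : ℕ) (γ : ℝ) : ℝ≥0∞ :=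
  algError r s μ₁ μ₂ p δ (hyperbolicCross r n γ) (truncation r (hyperbolicCross r n γ))

/-- `x ≍ y` with explicit constants: `c₁ y ≤ x ≤ c₂ y`. -/
def Between (c₁ c₂ x y : ℝ) : Prop := c₁ * y ≤ x ∧ x ≤ c₂ * y

/-- `x ≍ y` with explicit constants, for a quantity `x ∈ [0, ∞]` and a real number `y`. -/
def EBetween (c₁ c₂ : ℝ) (x : ℝ≥0∞) (y : ℝ) : Prop :=
  ENNReal.ofReal (c₁ * y) ≤ x ∧ x ≤ ENNReal.ofReal (c₂ * y)

end GalerkinRadius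

/-!
The Legendre polynomials satisfy `|φ_k^{(r)}(t)| ≤ φ_k^{(r)}(1) ≍ k^{2r+1/2}` on `[-1,1]`
(`abs_legendre_deriv_le`, `le_legendre_deriv_one`): the values at `±1` satisfy a recursion in `r`
that comes from the Gegenbauer equation (`legendre_ode`), and the same equation shows that a
quadratic energy increases towards the endpoints. So in `C(Q)` the term of index `(k, j)` has the
size `k^{2r+1/2} j^{1/2}` times the coefficient.

Upper bounds (`crossError_le`). Outside the cross `k j^γ ≤ n`, Hölder's inequality in each row `j`
and then across the rows bounds the series by `n^{-α}`
(`sum_mul_hat_rpow_outside_cross_le`); the condition on `γ`, or `μ₂ > μ₁ - 2r` if `γ = 1`, makes the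
sum over the rows finite. Inside the cross, the noise contributes at most a constant times
`δ n^{2r+3/2-1/p} = δ n^{β-α}` (`sum_mul_hat_rpow_cross_le`). For `n ≍ δ^{-1/β}` both are of the
order `δ^{α/β}`. The cross has about `n` points if `γ > 1` and about `n ln n` if `γ = 1`.

Lower bounds (`le_minRadius`). Whatever the `N` indices of the information are, a function whose
coefficients are constant on about `N` unused indices `(k, 0)` with `k ≍ N`, and vanish elsewhere,
can be scaled into the class with coefficients of the order `N^{-μ₁-1/s}`. It and its negative have
zero information, and the value of `f^{(r,0)}` at the corner `(1,1)` is of the order `N^{-α}`.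

The two-sided bounds for all `δ ∈ (0,1)` follow for small `δ` from these estimates, and for the
other `δ` from the boundedness of `f^{(r,0)}` on the class, since `N` is bounded as well.
-/

namespace GalerkinRadius

/-! ### Derivatives of Legendre polynomials -/

open Polynomial in
/-- The differential equation of the derivatives `y_m` of `(X² - 1)^k`, obtained by differentiating
`(X² - 1) y_0' = 2 k X y_0` repeatedly. -/
theorem rodrigues_ode (k m : ℕ) :
    (X ^ 2 - 1) * derivative^[m + 2] ((X ^ 2 - 1 : ℝ[X]) ^ k) +
      C (2 * ((m : ℝ) + 1 - k)) * X * derivative^[m + 1] ((X ^ 2 - 1 : ℝ[X]) ^ k) +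
      C (((m : ℝ) + 1) * (m - 2 * k)) * derivative^[m] ((X ^ 2 - 1 : ℝ[X]) ^ k) = 0 := by
  induction m with
  | zero =>
    have h1 : (X ^ 2 - 1) * derivative ((X ^ 2 - 1 : ℝ[X]) ^ k) =
        C (2 * (k : ℝ)) * X * (X ^ 2 - 1 : ℝ[X]) ^ k := by
      rcases k with _ | k
      · simp
      · simp only [derivative_pow, derivative_sub, derivative_X, derivative_one, Nat.add_sub_cancel]
        simp only [Nat.cast_add, Nat.cast_one, map_mul, map_add, map_natCast, map_one, map_ofNat]
        ring_nf
    generalize (X ^ 2 - 1 : ℝ[X]) ^ k = W at h1 ⊢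
    have h2 := congrArg derivative h1
    have hd : derivative (X ^ 2 - 1 : ℝ[X]) = 2 * X := by
      rw [derivative_sub, derivative_X_sq, derivative_one, sub_zero, map_ofNat]
    simp only [derivative_mul, hd, derivative_X, derivative_C] at h2
    simp only [Function.iterate_succ, Function.iterate_zero, Function.comp_apply, id, map_mul,
      map_add, map_sub, map_natCast, map_one, map_ofNat, Nat.cast_zero, C_0] at h2 ⊢
    linear_combination h2
  | succ m ih =>
    have h2 := congrArg derivative ih
    simp only [derivative_mul, derivative_add, derivative_sub, derivative_pow, derivative_X,
      derivative_one, derivative_C, ← Function.iterate_succ_apply' (⇑(derivative (R := ℝ))),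
      derivative_zero] at h2
    simp only [map_mul, map_add, map_sub, map_natCast, map_one, map_ofNat, Nat.cast_ofNat,
      Nat.cast_add, Nat.cast_one, Nat.succ_eq_add_one] at h2 ⊢
    linear_combination h2

open Polynomial in
/-- At a zero `a` of order `k`, the Leibniz rule leaves one term of the `k`-th derivative. -/
theorem iterate_derivative_eval_of_factor (k : ℕ) (a : ℝ) (q : ℝ[X]) :
    (derivative^[k] ((X - C a) ^ k * q)).eval a = k.factorial * q.eval a := by
  rw [← factorial_smul_hasseDeriv, LinearMap.smul_apply, eval_smul, ← taylor_coeff, taylor_mul]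
  have : (taylor a ((X - C a) ^ k)) = X ^ k := by
    rw [taylor_pow]; simp
  rw [this, coeff_X_pow_mul', if_pos le_rfl, Nat.sub_self, taylor_coeff_zero]
  simp

/-- The scalar by which Rodrigues' formula is multiplied in `legendre`. -/
noncomputable def legendreScale (k : ℕ) : ℝ :=
  Real.sqrt ((k : ℝ) + 1 / 2) * ((2 : ℝ) ^ k * (k.factorial : ℝ))⁻¹

open Polynomial in
theorem iterate_derivative_legendre (k r : ℕ) :
    derivative^[r] (legendre k) =
      C (legendreScale k) * derivative^[k + r] ((X ^ 2 - 1 : ℝ[X]) ^ k) := by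
  rw [legendre, ← legendreScale, iterate_derivative_C_mul, ← Function.iterate_add_apply, add_comm]

open Polynomial in
/-- The Gegenbauer equation of the derivatives of the Legendre polynomials. -/
theorem legendre_ode (k r : ℕ) (x : ℝ) :
    (1 - x ^ 2) * (derivative^[r + 2] (legendre k)).eval x =
      2 * (r + 1) * x * (derivative^[r + 1] (legendre k)).eval x -
        ((k : ℝ) * (k + 1) - r * (r + 1)) * (derivative^[r] (legendre k)).eval x := by
  have h := congrArg (eval x) (rodrigues_ode k (k + r))
  simp only [iterate_derivative_legendre, eval_add, eval_mul, eval_sub, eval_pow, eval_X, eval_one,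
    eval_C, eval_zero, ← add_assoc] at h ⊢
  push_cast at h
  linear_combination (-legendreScale k) * h

theorem abs_eq_one_of_sq_eq_one {a : ℝ} (ha : a ^ 2 = 1) : |a| = 1 := by
  rw [← sq_eq_sq₀ (abs_nonneg _) zero_le_one, sq_abs, ha, one_pow]

open Polynomial in
theorem legendre_eval_endpoint (k : ℕ) {a : ℝ} (ha : a ^ 2 = 1) :
    (legendre k).eval a = a ^ k * Real.sqrt ((k : ℝ) + 1 / 2) := by
  have hfac : (X ^ 2 - 1 : ℝ[X]) ^ k = (X - C a) ^ k * (X + C a) ^ k := by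
    rw [← mul_pow]; congr 1
    have : (C a : ℝ[X]) ^ 2 = 1 := by rw [← C_pow, ha, C_1]
    linear_combination this
  have h := iterate_derivative_legendre k 0
  simp only [Function.iterate_zero, id, add_zero] at h
  rw [h, eval_mul, eval_C, hfac, iterate_derivative_eval_of_factor]
  simp only [eval_pow, eval_add, eval_X, eval_C]
  have : (k.factorial : ℝ) ≠ 0 := by positivity
  rw [← two_mul, mul_pow, legendreScale]
  field_simp

theorem abs_legendre_eval_endpoint (k : ℕ) {a : ℝ} (ha : a ^ 2 = 1) :
    |(legendre k).eval a| = Real.sqrt ((k : ℝ) + 1 / 2) := by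
  rw [legendre_eval_endpoint k ha, abs_mul, abs_pow, abs_eq_one_of_sq_eq_one ha, one_pow, one_mul,
    abs_of_nonneg (Real.sqrt_nonneg _)]

open Polynomial in
/-- At `a = ±1` the leading coefficient of the Gegenbauer equation vanishes, which leaves a
recursion in the order of the derivative. -/
theorem legendre_deriv_succ_endpoint (k r : ℕ) {a : ℝ} (ha : a ^ 2 = 1) :
    2 * ((r : ℝ) + 1) * a * (derivative^[r + 1] (legendre k)).eval a =
      ((k : ℝ) * (k + 1) - r * (r + 1)) * (derivative^[r] (legendre k)).eval a := by
  have h := legendre_ode k r a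
  rw [ha, sub_self, zero_mul] at h
  linarith

open Polynomial in
theorem abs_legendre_deriv_succ_endpoint (k r : ℕ) {a : ℝ} (ha : a ^ 2 = 1) :
    2 * ((r : ℝ) + 1) * |(derivative^[r + 1] (legendre k)).eval a| =
      |(k : ℝ) * (k + 1) - r * (r + 1)| * |(derivative^[r] (legendre k)).eval a| := by
  have := congrArg abs (legendre_deriv_succ_endpoint k r ha)
  rwa [abs_mul (2 * ((r : ℝ) + 1) * a), abs_mul (2 * ((r : ℝ) + 1)), abs_eq_one_of_sq_eq_one ha,
    mul_one, abs_of_pos (by positivity), abs_mul] at this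

theorem natDegree_legendre_le (k : ℕ) : (legendre k).natDegree ≤ k := by
  unfold legendre
  refine (Polynomial.natDegree_C_mul_le _ _).trans ?_
  refine (Polynomial.natDegree_iterate_derivative _ _).trans ?_
  have : ((Polynomial.X ^ 2 - 1 : Polynomial ℝ) ^ k).natDegree ≤ 2 * k := by
    refine Polynomial.natDegree_pow_le.trans ?_
    rw [mul_comm]
    gcongr
    compute_degree
  omega

theorem iterate_derivative_legendre_eq_zero {k r : ℕ} (h : k < r) :
    Polynomial.derivative^[r] (legendre k) = 0 :=
  Polynomial.iterate_derivative_eq_zero ((natDegree_legendre_le k).trans_lt h)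

theorem abs_legendre_deriv_endpoint_le (k r : ℕ) {a : ℝ} (ha : a ^ 2 = 1) :
    |(Polynomial.derivative^[r] (legendre k)).eval a| ≤
      Real.sqrt ((k : ℝ) + 1 / 2) * (k : ℝ) ^ (2 * r) := by
  induction r with
  | zero => simpa using (abs_legendre_eval_endpoint k ha).le
  | succ r ih =>
    rcases lt_or_ge k (r + 1) with hk | hk
    · rw [iterate_derivative_legendre_eq_zero hk]; simp; positivity
    have h := abs_legendre_deriv_succ_endpoint k r ha
    have hk' : (r : ℝ) + 1 ≤ k := by exact_mod_cast hk
    have hr0 : (0 : ℝ) ≤ r := by positivity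
    have hle : |(k : ℝ) * (k + 1) - r * (r + 1)| ≤ 2 * k ^ 2 := by
      rw [abs_of_nonneg (by nlinarith)]; nlinarith
    have h2 : 2 * |(Polynomial.derivative^[r + 1] (legendre k)).eval a| ≤
        2 * k ^ 2 * (Real.sqrt ((k : ℝ) + 1 / 2) * (k : ℝ) ^ (2 * r)) := by
      calc _ ≤ 2 * ((r : ℝ) + 1) * |(Polynomial.derivative^[r + 1] (legendre k)).eval a| := by
            nlinarith [abs_nonneg ((Polynomial.derivative^[r + 1] (legendre k)).eval a)]
        _ ≤ _ := by rw [h]; gcongr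
    have : (k : ℝ) ^ (2 * (r + 1)) = k ^ 2 * k ^ (2 * r) := by ring
    rw [this]; linarith

/-- The lower bound needs `k ≥ 2 r`, so that no factor `k (k + 1) - i (i + 1)`, `i < r`, of the
recursion is small compared with `k ^ 2`. -/
theorem le_legendre_deriv_one (r : ℕ) : ∃ c > (0 : ℝ), ∀ k : ℕ, 2 * r ≤ k →
    c * (Real.sqrt ((k : ℝ) + 1 / 2) * (k : ℝ) ^ (2 * r)) ≤
      (Polynomial.derivative^[r] (legendre k)).eval 1 := by
  induction r with
  | zero => exact ⟨1, one_pos, fun k _ => by simpa using (legendre_eval_endpoint k (one_pow 2)).ge⟩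
  | succ r ih =>
    obtain ⟨c, hc, ih⟩ := ih
    refine ⟨c / (4 * (r + 1)), by positivity, fun k hk => ?_⟩
    have h := legendre_deriv_succ_endpoint k r (one_pow 2)
    rw [mul_one] at h
    have hk' : 2 * ((r : ℝ) + 1) ≤ k := by exact_mod_cast hk
    have hr0 : (0 : ℝ) ≤ r := by positivity
    have hle : (k : ℝ) ^ 2 / 2 ≤ (k : ℝ) * (k + 1) - r * (r + 1) := by nlinarith
    have h2 : (k : ℝ) ^ 2 / 2 * (c * (Real.sqrt ((k : ℝ) + 1 / 2) * (k : ℝ) ^ (2 * r))) ≤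
        2 * ((r : ℝ) + 1) * (Polynomial.derivative^[r + 1] (legendre k)).eval 1 := by
      rw [h]
      exact mul_le_mul hle (ih k (by omega)) (by positivity) (by nlinarith)
    have : (k : ℝ) ^ (2 * (r + 1)) = k ^ 2 * k ^ (2 * r) := by ring
    rw [this, div_mul_eq_mul_div, div_le_iff₀ (by positivity)]
    linarith

/-- The maximum of `|φ_k^{(r)}|` on `[-1,1]` is at an endpoint: by the Gegenbauer equation the
energy `λ y² + (1 - x²) y'²` of `y = φ_k^{(r)}`, where `λ = k (k + 1) - r (r + 1)`, has the
derivative `2 (2 r + 1) x y'²`, hence increases away from `0`. -/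
theorem abs_legendre_deriv_le (k r : ℕ) {x : ℝ} (hx : x ∈ Icc (-1 : ℝ) 1) :
    |(Polynomial.derivative^[r] (legendre k)).eval x| ≤
      Real.sqrt ((k : ℝ) + 1 / 2) * (k : ℝ) ^ (2 * r) := by
  rcases lt_trichotomy k r with hk | rfl | hk
  · rw [iterate_derivative_legendre_eq_zero hk]; simp; positivity
  · have hconst : (Polynomial.derivative^[k] (legendre k)).eval x =
        (Polynomial.derivative^[k] (legendre k)).eval 1 := by
      have : (Polynomial.derivative^[k] (legendre k)).natDegree ≤ 0 :=
        (Polynomial.natDegree_iterate_derivative _ _).trans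
          (by have := natDegree_legendre_le k; omega)
      rw [Polynomial.eq_C_of_natDegree_le_zero this]; simp
    rw [hconst]
    exact abs_legendre_deriv_endpoint_le k k (one_pow 2)
  set y : ℝ → ℝ := fun x => (Polynomial.derivative^[r] (legendre k)).eval x with hy
  set y' : ℝ → ℝ := fun x => (Polynomial.derivative^[r + 1] (legendre k)).eval x with hy'
  set y'' : ℝ → ℝ := fun x => (Polynomial.derivative^[r + 2] (legendre k)).eval x with hy''
  have d1 : ∀ x, HasDerivAt y (y' x) x := fun x => by
    simp only [hy, hy', Function.iterate_succ_apply']; exact Polynomial.hasDerivAt _ _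
  have d2 : ∀ x, HasDerivAt y' (y'' x) x := fun x => by
    simp only [hy', hy'']; rw [Function.iterate_succ_apply' _ (r + 1)]
    exact Polynomial.hasDerivAt _ _
  set lam : ℝ := (k : ℝ) * (k + 1) - r * (r + 1) with hlam
  have hlam0 : 0 < lam := by
    have : (r : ℝ) + 1 ≤ k := by exact_mod_cast hk
    have hr0 : (0 : ℝ) ≤ r := by positivity
    nlinarith
  set u : ℝ → ℝ := fun x => lam * y x ^ 2 + (1 - x ^ 2) * y' x ^ 2 with hu
  have du : ∀ x, HasDerivAt u (2 * (2 * r + 1) * x * y' x ^ 2) x := fun x => by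
    have h1 := (((d1 x).pow 2).const_mul lam).add
      ((((hasDerivAt_id x).pow 2).const_sub 1).mul ((d2 x).pow 2))
    refine h1.congr_deriv ?_
    have := legendre_ode k r x
    simp only [Pi.pow_apply, Nat.cast_ofNat, id, Nat.add_one_sub_one, pow_one, mul_one]
    change (1 - x ^ 2) * y'' x = 2 * (r + 1) * x * y' x - lam * y x at this
    linear_combination (2 * y' x) * this
  have key : ∃ a : ℝ, a ^ 2 = 1 ∧ u x ≤ u a := by
    rcases le_total 0 x with h0 | h0
    · refine ⟨1, one_pow 2, ?_⟩
      have hmono : MonotoneOn u (Icc 0 1) := monotoneOn_of_deriv_nonneg (convex_Icc 0 1)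
        (fun z _ => (du z).continuousAt.continuousWithinAt)
        (fun z _ => (du z).differentiableAt.differentiableWithinAt) fun z hz => by
          rw [interior_Icc] at hz
          rw [(du z).deriv]
          have := hz.1
          positivity
      exact hmono ⟨h0, hx.2⟩ ⟨zero_le_one, le_rfl⟩ hx.2
    · refine ⟨-1, by norm_num, ?_⟩
      have hanti : AntitoneOn u (Icc (-1) 0) := antitoneOn_of_deriv_nonpos (convex_Icc (-1) 0)
        (fun z _ => (du z).continuousAt.continuousWithinAt)
        (fun z _ => (du z).differentiableAt.differentiableWithinAt) fun z hz => by
          rw [interior_Icc] at hz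
          rw [(du z).deriv]
          have h1 : 2 * (2 * (r : ℝ) + 1) * z ≤ 0 :=
            mul_nonpos_of_nonneg_of_nonpos (by positivity) hz.2.le
          exact mul_nonpos_of_nonpos_of_nonneg h1 (sq_nonneg _)
      exact hanti ⟨le_rfl, by norm_num⟩ ⟨hx.1, h0⟩ hx.1
  obtain ⟨a, ha, hua⟩ := key
  refine le_trans ?_ (abs_legendre_deriv_endpoint_le k r ha)
  change |y x| ≤ |y a|
  rw [← sq_le_sq]
  simp only [hu, ha, sub_self, zero_mul, add_zero] at hua
  have : 0 ≤ (1 - x ^ 2) * y' x ^ 2 :=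
    mul_nonneg (by nlinarith [hx.1, hx.2]) (sq_nonneg _)
  exact le_of_mul_le_mul_left (by linarith) hlam0

/-- Legendre polynomials of different degrees are orthogonal, because the Legendre equation is
self-adjoint: `(1 - x²) (φ_k' φ_l - φ_k φ_l')` vanishes at `±1` and has the derivative
`(l (l + 1) - k (k + 1)) φ_k φ_l`. -/
theorem integral_legendre_mul_legendre {k l : ℕ} (hkl : k ≠ l) :
    ∫ x in (-1 : ℝ)..1, (legendre k).eval x * (legendre l).eval x = 0 := by
  have d1 : ∀ (m : ℕ) (x : ℝ), HasDerivAt (fun x => (legendre m).eval x)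
      ((Polynomial.derivative^[1] (legendre m)).eval x) x := fun m x => by
    simpa using Polynomial.hasDerivAt (legendre m) x
  have d2 : ∀ (m : ℕ) (x : ℝ), HasDerivAt (fun x => (Polynomial.derivative^[1] (legendre m)).eval x)
      ((Polynomial.derivative^[2] (legendre m)).eval x) x := fun m x => by
    simpa using Polynomial.hasDerivAt (Polynomial.derivative (legendre m)) x
  have hd : ∀ x ∈ uIcc (-1 : ℝ) 1, HasDerivAt (fun x => (1 - x ^ 2) *
      ((Polynomial.derivative^[1] (legendre k)).eval x * (legendre l).eval x -
        (legendre k).eval x * (Polynomial.derivative^[1] (legendre l)).eval x))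
      (((l : ℝ) * (l + 1) - k * (k + 1)) * ((legendre k).eval x * (legendre l).eval x)) x := by
    intro x _
    have h := (((hasDerivAt_id x).pow 2).const_sub 1).mul
      (((d2 k x).mul (d1 l x)).sub ((d1 k x).mul (d2 l x)))
    refine h.congr_deriv ?_
    have e1 := legendre_ode k 0 x
    have e2 := legendre_ode l 0 x
    simp only [zero_add, Nat.cast_zero, Function.iterate_zero, id, sub_zero, mul_one] at e1 e2
    simp only [Nat.cast_ofNat, id, Nat.add_one_sub_one, pow_one, mul_one, Pi.pow_apply,
      Pi.sub_apply, Pi.mul_apply]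
    linear_combination ((legendre l).eval x) * e1 - ((legendre k).eval x) * e2
  have hI := intervalIntegral.integral_eq_sub_of_hasDerivAt hd
    (Continuous.intervalIntegrable (by fun_prop) _ _)
  rw [intervalIntegral.integral_const_mul] at hI
  have hne : ((l : ℝ) * (l + 1) - k * (k + 1)) ≠ 0 := by
    have h1 : ((l : ℝ) - k) ≠ 0 := sub_ne_zero.mpr (by exact_mod_cast hkl.symm)
    have h2 : ((l : ℝ) + k + 1) ≠ 0 := by positivity
    have : ((l : ℝ) * (l + 1) - k * (k + 1)) = (l - k) * (l + k + 1) := by ring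
    rw [this]; exact mul_ne_zero h1 h2
  norm_num at hI
  exact hI.resolve_left hne

theorem integral_legendre_sq_pos (k : ℕ) :
    0 < ∫ x in (-1 : ℝ)..1, (legendre k).eval x * (legendre k).eval x := by
  refine intervalIntegral.integral_pos (by norm_num) (by fun_prop) (fun x _ => mul_self_nonneg _)
    ⟨1, by norm_num, ?_⟩
  have h := abs_legendre_eval_endpoint k (one_pow 2)
  rw [← abs_mul_abs_self, h]
  positivity

/-! ### Functions with prescribed Fourier-Legendre coefficients -/

/-- The function with the Fourier-Legendre coefficients `c` at the points `(k, 0)`, `k ∈ S`, and `0`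
elsewhere. The division by the squared norms spares their computation. -/
noncomputable def testFun (S : Finset ℕ) (c : ℝ) (x : ℝ × ℝ) : ℝ :=
  ∑ k ∈ S, c / ((∫ t in (-1 : ℝ)..1, (legendre k).eval t * (legendre k).eval t) *
    ∫ t in (-1 : ℝ)..1, (legendre 0).eval t * (legendre 0).eval t) *
    ((legendre k).eval x.1 * (legendre 0).eval x.2)

theorem memLp_testFun (S : Finset ℕ) (c : ℝ) :
    MemLp (testFun S c) 2 (volume.restrict square) := by
  have hc : Continuous (testFun S c) := by unfold testFun; fun_prop
  have hK : IsCompact square := isCompact_Icc.prod isCompact_Icc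
  obtain ⟨B, hB⟩ := hK.exists_bound_of_continuousOn hc.continuousOn
  have : IsFiniteMeasure (volume.restrict square) := ⟨by
    simpa using hK.measure_lt_top⟩
  refine MemLp.of_bound hc.aestronglyMeasurable B ?_
  exact (ae_restrict_iff' hK.measurableSet).mpr (Filter.Eventually.of_forall hB)

theorem coeff_testFun (S : Finset ℕ) (c : ℝ) (i : ℕ × ℕ) :
    coeff (testFun S c) i = if i.1 ∈ S ∧ i.2 = 0 then c else 0 := by
  classical
  set h : ℕ → ℝ := fun k => ∫ t in (-1 : ℝ)..1, (legendre k).eval t * (legendre k).eval t with hh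
  have hpos : ∀ k, h k ≠ 0 := fun k => (integral_legendre_sq_pos k).ne'
  set g : ℕ → ℕ → ℝ := fun k l => ∫ t in (-1 : ℝ)..1, (legendre k).eval t * (legendre l).eval t
    with hg
  have hg' : ∀ k l, g k l = if k = l then h k else 0 := fun k l => by
    split_ifs with hkl
    · subst hkl; rfl
    · exact integral_legendre_mul_legendre hkl
  -- every summand is a product of functions of one variable, so the double integral factors
  have hinner : ∀ t : ℝ, ∫ τ in (-1 : ℝ)..1,
      testFun S c (t, τ) * (legendre i.1).eval t * (legendre i.2).eval τ =
      (∑ k ∈ S, c / (h k * h 0) * ((legendre k).eval t * (legendre i.1).eval t)) * g 0 i.2 := by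
    intro t
    rw [hg, ← intervalIntegral.integral_const_mul]
    congr 1; ext τ
    simp only [testFun, Finset.sum_mul]
    exact Finset.sum_congr rfl fun k _ => by ring
  have hsum : coeff (testFun S c) i = (∑ k ∈ S, c / (h k * h 0) * g k i.1) * g 0 i.2 := by
    unfold coeff
    simp_rw [hinner]
    rw [intervalIntegral.integral_mul_const, intervalIntegral.integral_finsetSum]
    · simp_rw [intervalIntegral.integral_const_mul]; rfl
    · exact fun k _ => Continuous.intervalIntegrable (by fun_prop) _ _
  rw [hsum]
  simp only [hg', mul_ite, mul_zero, Finset.sum_ite_eq']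
  rcases eq_or_ne i.2 0 with h0 | h0
  · by_cases hS : i.1 ∈ S
    · have := hpos i.1; have := hpos 0
      simp only [h0, hS, if_true, and_self]; field_simp
    · simp [hS]
  · simp [h0, h0.symm]

/-! ### Weighted sums over hyperbolic crosses -/

/-- The number `max(1,k)` of the weights, as a real number. -/
noncomputable def hat (k : ℕ) : ℝ := ((max 1 k : ℕ) : ℝ)

theorem one_le_hat (k : ℕ) : 1 ≤ hat k := by
  unfold hat; exact_mod_cast le_max_left 1 k

theorem hat_pos (k : ℕ) : 0 < hat k := one_pos.trans_le (one_le_hat k)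

theorem hat_of_pos {k : ℕ} (hk : 1 ≤ k) : hat k = k := by
  rw [hat, max_eq_right hk]

theorem hat_zero : hat 0 = 1 := by simp [hat]

theorem natCast_le_hat (k : ℕ) : (k : ℝ) ≤ hat k := by
  unfold hat; exact_mod_cast le_max_right 1 k

/-- The factor `2` accounts for `hat 0 = hat 1 = 1`. -/
theorem card_le_of_hat_le {ι : Type*} {S : Finset ι} {g : ι → ℕ} (hg : Set.InjOn g S) {y : ℝ}
    (hy : 0 ≤ y) (h : ∀ i ∈ S, hat (g i) ≤ y) : (S.card : ℝ) ≤ 2 * y := by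
  rcases S.eq_empty_or_nonempty with rfl | ⟨i, hi⟩
  · simpa using hy
  have hy1 : 1 ≤ y := (one_le_hat _).trans (h i hi)
  have hcard : S.card ≤ (Finset.range (⌊y⌋₊ + 1)).card := by
    refine Finset.card_le_card_of_injOn g (fun i hi => ?_) hg
    simp only [Finset.coe_range, Set.mem_Iio]
    exact Nat.lt_succ_of_le (Nat.le_floor ((natCast_le_hat _).trans (h i hi)))
  have : (S.card : ℝ) ≤ ⌊y⌋₊ + 1 := by
    rw [Finset.card_range] at hcard; exact_mod_cast hcard
  have := Nat.floor_le hy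
  linarith

theorem sum_le_card_rpow_mul {ι : Type*} (S : Finset ι) {s : ℝ} (hs : 1 ≤ s) {x : ι → ℝ}
    (hx : ∀ i, 0 ≤ x i) :
    ∑ i ∈ S, x i ≤ (S.card : ℝ) ^ (1 - 1 / s) * (∑ i ∈ S, x i ^ s) ^ (1 / s) := by
  have := Real.inner_le_weight_mul_Lp_of_nonneg S hs (fun _ => 1) x (fun _ => zero_le_one) hx
  simpa [one_div] using this

/-- Hölder's inequality for the tail of a power weight. Dyadic blocks reduce it to the power mean
inequality and a geometric series, which treats `s = 1` and `s > 1` alike. -/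
theorem sum_mul_hat_rpow_tail_le {s w : ℝ} (hs : 1 ≤ s) (hw : 1 - 1 / s < w) :
    ∃ C > (0 : ℝ), ∀ (ι : Type) (S : Finset ι) (g : ι → ℕ) (x : ι → ℝ) (K : ℝ), Set.InjOn g S →
      (∀ i, 0 ≤ x i) → 0 < K → (∀ i ∈ S, K < hat (g i)) →
      ∑ i ∈ S, x i * hat (g i) ^ (-w) ≤
        C * K ^ (-(w - 1 + 1 / s)) * (∑ i ∈ S, x i ^ s) ^ (1 / s) := by
  classical
  set θ := w - 1 + 1 / s with hθ
  have hθ0 : 0 < θ := by linarith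
  have hs1 : 1 / s ≤ 1 := by rw [div_le_one (by linarith)]; exact hs
  have hw0 : 0 ≤ w := by linarith
  set q : ℝ := 2 ^ (-θ) with hq
  have hq0 : 0 < q := by positivity
  have hq1 : q < 1 := Real.rpow_lt_one_of_one_lt_of_neg one_lt_two (by linarith)
  have hgeo : 0 < (1 - q)⁻¹ := inv_pos.mpr (by linarith)
  refine ⟨4 * (1 - q)⁻¹, by positivity, fun ι S g x K hg hx hK hS => ?_⟩
  have hX : 0 ≤ (∑ i ∈ S, x i ^ s) ^ (1 / s) :=
    Real.rpow_nonneg (Finset.sum_nonneg fun i _ => Real.rpow_nonneg (hx i) _) _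
  have hex : ∀ i, ∃ a : ℕ, i ∈ S → (2 : ℝ) ^ a ≤ hat (g i) / K ∧ hat (g i) / K < 2 ^ (a + 1) := by
    intro i
    by_cases hi : i ∈ S
    · obtain ⟨a, ha⟩ := exists_nat_pow_near ((one_le_div hK).mpr (hS i hi).le) one_lt_two
      exact ⟨a, fun _ => ha⟩
    · exact ⟨0, fun h => absurd h hi⟩
  -- the block of index `b` consists of the `i` with `K 2^b ≤ hat (g i) < K 2^(b+1)`
  choose a ha using hex
  have hblock : ∀ b : ℕ, ∑ i ∈ S with a i = b, x i * hat (g i) ^ (-w) ≤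
      4 * K ^ (-θ) * (∑ i ∈ S, x i ^ s) ^ (1 / s) * q ^ b := by
    intro b
    set F := S.filter (fun i => a i = b) with hF
    set L : ℝ := K * 2 ^ b with hL
    have hL0 : 0 < L := by positivity
    have hFb : ∀ i ∈ F, L ≤ hat (g i) ∧ hat (g i) ≤ 2 * L := by
      intro i hi
      obtain ⟨hiS, hib⟩ := Finset.mem_filter.mp hi
      have h := ha i hiS
      rw [hib, le_div_iff₀ hK, div_lt_iff₀ hK, pow_succ] at h
      constructor
      · rw [hL]; linarith [h.1]
      · rw [hL]; linarith [h.2]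
    have hcard : (F.card : ℝ) ≤ 4 * L := by
      have := card_le_of_hat_le (S := F) (g := g)
        (hg.mono (by exact_mod_cast Finset.filter_subset _ _)) (y := 2 * L) (by positivity)
        (fun i hi => (hFb i hi).2)
      linarith
    have hsub : (∑ i ∈ F, x i ^ s) ^ (1 / s) ≤ (∑ i ∈ S, x i ^ s) ^ (1 / s) := by
      refine Real.rpow_le_rpow (Finset.sum_nonneg fun i _ => Real.rpow_nonneg (hx i) _) ?_
        (by positivity)
      exact Finset.sum_le_sum_of_subset_of_nonneg (Finset.filter_subset _ _)
        fun i _ _ => Real.rpow_nonneg (hx i) _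
    calc ∑ i ∈ F, x i * hat (g i) ^ (-w) ≤ ∑ i ∈ F, x i * L ^ (-w) := by
          refine Finset.sum_le_sum fun i hi => mul_le_mul_of_nonneg_left ?_ (hx i)
          exact Real.rpow_le_rpow_of_nonpos hL0 (hFb i hi).1 (by linarith)
      _ = (∑ i ∈ F, x i) * L ^ (-w) := by rw [Finset.sum_mul]
      _ ≤ ((4 * L) ^ (1 - 1 / s) * (∑ i ∈ S, x i ^ s) ^ (1 / s)) * L ^ (-w) := by
          refine mul_le_mul_of_nonneg_right ((sum_le_card_rpow_mul F hs hx).trans ?_)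
            (by positivity)
          exact mul_le_mul (Real.rpow_le_rpow (by positivity) hcard (by linarith)) hsub
            (Real.rpow_nonneg (Finset.sum_nonneg fun i _ => Real.rpow_nonneg (hx i) _) _)
            (by positivity)
      _ = 4 ^ (1 - 1 / s) * L ^ (-θ) * (∑ i ∈ S, x i ^ s) ^ (1 / s) := by
          rw [Real.mul_rpow (by norm_num) hL0.le]
          have : L ^ (-θ) = L ^ (1 - 1 / s) * L ^ (-w) := by
            rw [← Real.rpow_add hL0]; congr 1; rw [hθ]; ring
          rw [this]; ring
      _ ≤ 4 * L ^ (-θ) * (∑ i ∈ S, x i ^ s) ^ (1 / s) := by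
          have h4 : (4 : ℝ) ^ (1 - 1 / s) ≤ 4 := by
            conv_rhs => rw [← Real.rpow_one 4]
            exact Real.rpow_le_rpow_of_exponent_le (by norm_num)
              (by have : 0 < 1 / s := by positivity
                  linarith)
          gcongr
      _ = _ := by
          have : L ^ (-θ) = K ^ (-θ) * q ^ b := by
            rw [hL, Real.mul_rpow hK.le (by positivity), hq, ← Real.rpow_natCast 2 b,
              ← Real.rpow_mul (by norm_num), ← Real.rpow_mul_natCast (by norm_num),
              mul_comm (b : ℝ)]
          rw [this]; ring
  rw [← Finset.sum_fiberwise_of_maps_to (t := S.image a) (g := a)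
    (fun i hi => Finset.mem_image_of_mem a hi)]
  calc _ ≤ ∑ b ∈ S.image a, 4 * K ^ (-θ) * (∑ i ∈ S, x i ^ s) ^ (1 / s) * q ^ b :=
        Finset.sum_le_sum fun b _ => hblock b
    _ = 4 * K ^ (-θ) * (∑ i ∈ S, x i ^ s) ^ (1 / s) * ∑ b ∈ S.image a, q ^ b := by
        rw [Finset.mul_sum]
    _ ≤ 4 * K ^ (-θ) * (∑ i ∈ S, x i ^ s) ^ (1 / s) * (1 - q)⁻¹ := by
        refine mul_le_mul_of_nonneg_left ?_ (by positivity)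
        rw [← tsum_geometric_of_lt_one hq0.le hq1]
        exact (summable_geometric_of_lt_one hq0.le hq1).sum_le_tsum _ fun b _ => by positivity
    _ = _ := by ring

/-- Hölder's inequality outside a hyperbolic cross, by the one-dimensional inequality in each row
and then across the rows. -/
theorem sum_mul_hat_rpow_outside_cross_le {s u v γ : ℝ} (hs : 1 ≤ s) (hu : 1 - 1 / s < u)
    (hv : 1 - 1 / s < v - γ * (u - 1 + 1 / s)) :
    ∃ C > (0 : ℝ), ∀ (T : Finset (ℕ × ℕ)) (x : ℕ × ℕ → ℝ) (n : ℝ), (∀ i, 0 ≤ x i) → 0 < n →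
      (∀ i ∈ T, n < hat i.1 * hat i.2 ^ γ) → ∑ i ∈ T, x i ^ s ≤ 1 →
      ∑ i ∈ T, x i * (hat i.1 ^ (-u) * hat i.2 ^ (-v)) ≤ C * n ^ (-(u - 1 + 1 / s)) := by
  classical
  obtain ⟨C₁, hC₁, h1⟩ := sum_mul_hat_rpow_tail_le hs hu
  obtain ⟨C₂, hC₂, h2⟩ := sum_mul_hat_rpow_tail_le hs hv
  set θ := u - 1 + 1 / s with hθ
  set D : ℝ := C₂ * (1 / 2) ^ (-(v - γ * θ - 1 + 1 / s)) with hD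
  refine ⟨C₁ * D, by positivity, fun T x n hx hn hT hsum => ?_⟩
  -- `X j` is the `ℓ_s` norm of the row `j`
  set X : ℕ → ℝ := fun j => (∑ i ∈ T with i.2 = j, x i ^ s) ^ (1 / s) with hX
  have hin : ∀ j, 0 ≤ ∑ i ∈ T with i.2 = j, x i ^ s := fun j =>
    Finset.sum_nonneg fun i _ => Real.rpow_nonneg (hx i) _
  have hX0 : ∀ j, 0 ≤ X j := fun j => Real.rpow_nonneg (hin j) _
  have hXs : ∀ j, X j ^ s = ∑ i ∈ T with i.2 = j, x i ^ s := fun j => by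
    rw [hX]; simp only []
    rw [one_div, Real.rpow_inv_rpow (hin j) (by linarith)]
  have hrow : ∀ j, ∑ i ∈ T with i.2 = j, x i * (hat i.1 ^ (-u) * hat i.2 ^ (-v)) ≤
      C₁ * n ^ (-θ) * (X j * hat j ^ (-(v - γ * θ))) := by
    intro j
    have hj := hat_pos j
    have := h1 (ℕ × ℕ) (T.filter (fun i => i.2 = j)) Prod.fst x (n / hat j ^ γ)
      (fun i hi i' hi' h => Prod.ext h (by
        rw [(Finset.mem_filter.mp hi).2, (Finset.mem_filter.mp hi').2])) hx (by positivity)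
      (fun i hi => by
        obtain ⟨hiT, hij⟩ := Finset.mem_filter.mp hi
        rw [div_lt_iff₀ (by positivity), ← hij]; exact hT i hiT)
    calc _ = (∑ i ∈ T with i.2 = j, x i * hat i.1 ^ (-u)) * hat j ^ (-v) := by
          rw [Finset.sum_mul]
          refine Finset.sum_congr rfl fun i hi => ?_
          rw [(Finset.mem_filter.mp hi).2]; ring
      _ ≤ (C₁ * (n / hat j ^ γ) ^ (-θ) * X j) * hat j ^ (-v) := by gcongr
      _ = _ := by
          rw [Real.div_rpow hn.le (by positivity), ← Real.rpow_mul hj.le]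
          have : hat j ^ (-(v - γ * θ)) = hat j ^ (-v) / hat j ^ (γ * -θ) := by
            rw [← Real.rpow_sub hj]; congr 1; ring
          rw [this]; ring
  rw [← Finset.sum_fiberwise_of_maps_to (t := T.image Prod.snd) (g := Prod.snd)
    (fun i hi => Finset.mem_image_of_mem _ hi)]
  calc _ ≤ ∑ j ∈ T.image Prod.snd, C₁ * n ^ (-θ) * (X j * hat j ^ (-(v - γ * θ))) :=
        Finset.sum_le_sum fun j _ => hrow j
    _ = C₁ * n ^ (-θ) * ∑ j ∈ T.image Prod.snd, X j * hat j ^ (-(v - γ * θ)) := by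
        rw [Finset.mul_sum]
    _ ≤ C₁ * n ^ (-θ) * (D * (∑ j ∈ T.image Prod.snd, X j ^ s) ^ (1 / s)) := by
        refine mul_le_mul_of_nonneg_left ?_ (by positivity)
        -- any lower cutoff `K < 1` makes this the sum over all rows
        exact h2 ℕ (T.image Prod.snd) id X (1 / 2) (fun _ _ _ _ h => h) hX0 (by norm_num)
          fun j _ => by have := one_le_hat j; simp only [id]; linarith
    _ ≤ C₁ * n ^ (-θ) * (D * 1) := by
        gcongr
        simp_rw [hXs]
        rw [Finset.sum_fiberwise_of_maps_to (fun i hi => Finset.mem_image_of_mem _ hi)]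
        exact Real.rpow_le_one (Finset.sum_nonneg fun i _ => Real.rpow_nonneg (hx i) _) hsum
          (by positivity)
    _ = _ := by ring

theorem summable_hat_rpow_neg {γ : ℝ} (hγ : 1 < γ) : Summable fun j => hat j ^ (-γ) := by
  rw [← summable_nat_add_iff 1]
  have := (summable_nat_add_iff 1).mpr (Real.summable_nat_rpow.mpr (show -γ < -1 by linarith))
  refine this.congr fun j => ?_
  rw [hat_of_pos (by omega)]

/-- The influence of the noise inside a hyperbolic cross. Only the bound `δ` for the noise in each
row is used: the weights `hat j ^ (1/2)` of the rows are summable after the scaling of the rows. -/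
theorem sum_mul_hat_rpow_cross_le {e κ γ : ℝ} (he : 5 / 2 ≤ e) (hκ : 0 ≤ κ) (hκ1 : κ ≤ 1)
    (hγ : 1 ≤ γ) :
    ∃ C > (0 : ℝ), ∀ (T : Finset (ℕ × ℕ)) (ξ : ℕ × ℕ → ℝ) (n δ : ℝ), 0 < n → 0 ≤ δ →
      (∀ S : Finset (ℕ × ℕ), ∑ i ∈ S, |ξ i| ≤ (S.card : ℝ) ^ κ * δ) →
      (∀ i ∈ T, hat i.1 * hat i.2 ^ γ ≤ n) →
      ∑ i ∈ T, |ξ i| * (hat i.1 ^ e * hat i.2 ^ (1 / 2 : ℝ)) ≤ C * (δ * n ^ (e + κ)) := by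
  classical
  have hZs : Summable fun j => hat j ^ (-2 : ℝ) := summable_hat_rpow_neg one_lt_two
  set Z := ∑' j, hat j ^ (-2 : ℝ) with hZ
  have hterm : ∀ j, 0 ≤ hat j ^ (-2 : ℝ) := fun j => Real.rpow_nonneg (hat_pos j).le _
  have hZ0 : 0 < Z := hZs.tsum_pos hterm 0 (Real.rpow_pos_of_pos (hat_pos 0) _)
  refine ⟨2 * Z, by positivity, fun T ξ n δ hn hδ hξ hT => ?_⟩
  have hrow : ∀ j, ∑ i ∈ T with i.2 = j, |ξ i| * (hat i.1 ^ e * hat i.2 ^ (1 / 2 : ℝ)) ≤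
      2 * (δ * n ^ (e + κ)) * hat j ^ (-2 : ℝ) := by
    intro j
    have hj := hat_pos j
    set F := T.filter (fun i => i.2 = j) with hF
    set K := n / hat j ^ γ with hK
    have hK0 : 0 < K := by positivity
    have hFK : ∀ i ∈ F, hat i.1 ≤ K := fun i hi => by
      obtain ⟨hiT, hij⟩ := Finset.mem_filter.mp hi
      rw [hK, le_div_iff₀ (by positivity), ← hij]; exact hT i hiT
    have hcard : (F.card : ℝ) ≤ 2 * K := card_le_of_hat_le (g := Prod.fst)
      (fun i hi i' hi' h => Prod.ext h (by
        rw [(Finset.mem_filter.mp hi).2, (Finset.mem_filter.mp hi').2])) hK0.le hFK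
    calc _ ≤ ∑ i ∈ F, |ξ i| * (K ^ e * hat j ^ (1 / 2 : ℝ)) := by
          refine Finset.sum_le_sum fun i hi => ?_
          rw [(Finset.mem_filter.mp hi).2]
          have := Real.rpow_le_rpow (hat_pos _).le (hFK i hi) (by linarith : 0 ≤ e)
          gcongr
      _ = (∑ i ∈ F, |ξ i|) * (K ^ e * hat j ^ (1 / 2 : ℝ)) := by rw [Finset.sum_mul]
      _ ≤ ((2 * K) ^ κ * δ) * (K ^ e * hat j ^ (1 / 2 : ℝ)) := by
          refine mul_le_mul_of_nonneg_right ((hξ F).trans ?_) (by positivity)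
          gcongr
      _ = 2 ^ κ * (δ * (K ^ (e + κ) * hat j ^ (1 / 2 : ℝ))) := by
          rw [Real.mul_rpow (by norm_num) hK0.le, Real.rpow_add hK0]; ring
      _ ≤ 2 * (δ * (n ^ (e + κ) * hat j ^ (-2 : ℝ))) := by
          have h2 : (2 : ℝ) ^ κ ≤ 2 := by
            conv_rhs => rw [← Real.rpow_one 2]
            exact Real.rpow_le_rpow_of_exponent_le (by norm_num) hκ1
          have h3 : K ^ (e + κ) * hat j ^ (1 / 2 : ℝ) ≤ n ^ (e + κ) * hat j ^ (-2 : ℝ) := by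
            rw [hK, Real.div_rpow hn.le (by positivity), ← Real.rpow_mul hj.le, div_mul_eq_mul_div,
              mul_div_assoc, ← Real.rpow_sub hj]
            gcongr
            · exact one_le_hat j
            · nlinarith
          gcongr
      _ = _ := by ring
  rw [← Finset.sum_fiberwise_of_maps_to (t := T.image Prod.snd) (g := Prod.snd)
    (fun i hi => Finset.mem_image_of_mem _ hi)]
  calc _ ≤ ∑ j ∈ T.image Prod.snd, 2 * (δ * n ^ (e + κ)) * hat j ^ (-2 : ℝ) :=
        Finset.sum_le_sum fun j _ => hrow j
    _ = 2 * (δ * n ^ (e + κ)) * ∑ j ∈ T.image Prod.snd, hat j ^ (-2 : ℝ) := by rw [Finset.mul_sum]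
    _ ≤ 2 * (δ * n ^ (e + κ)) * Z := by
        gcongr
        exact hZs.sum_le_tsum _ fun j _ => hterm j
    _ = _ := by ring

theorem toReal_one_div_mem {p : ℝ≥0∞} (hp : 1 ≤ p) : 0 ≤ (1 / p).toReal ∧ (1 / p).toReal ≤ 1 := by
  refine ⟨ENNReal.toReal_nonneg, ?_⟩
  rw [one_div]
  exact ENNReal.toReal_le_of_le_ofReal zero_le_one (by simpa using hp)

/-- Hölder's inequality for the noise on a finite set of indices, for all `p ∈ [1, ∞]`. -/
theorem IsPerturbation.sum_abs_le {p : ℝ≥0∞} (hp : 1 ≤ p) {δ : ℝ} {c a : ℕ × ℕ → ℝ}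
    (h : IsPerturbation p δ c a) (S : Finset (ℕ × ℕ)) :
    ∑ i ∈ S, |c i - a i| ≤ (S.card : ℝ) ^ (1 - (1 / p).toReal) * δ := by
  obtain ⟨hmem, hnorm⟩ := h
  set ξ : lp (fun _ : ℕ × ℕ => ℝ) p := ⟨fun i => c i - a i, hmem⟩ with hξ
  have hp0 : p ≠ 0 := (zero_lt_one.trans_le hp).ne'
  rcases eq_or_ne p ∞ with rfl | hpt
  · have : ∑ i ∈ S, |c i - a i| ≤ S.card • δ := Finset.sum_le_card_nsmul _ _ _ fun i _ =>
      (lp.norm_apply_le_norm hp0 ξ i).trans hnorm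
    simpa using this
  · have hp1 : 1 ≤ p.toReal := by
      rwa [← ENNReal.toReal_one, ENNReal.toReal_le_toReal ENNReal.one_ne_top hpt]
    have h1 := sum_le_card_rpow_mul S hp1 (x := fun i => |c i - a i|) fun i => abs_nonneg _
    have h2 : ∑ i ∈ S, |c i - a i| ^ p.toReal ≤ ‖ξ‖ ^ p.toReal :=
      lp.sum_rpow_le_norm_rpow (by linarith) ξ S
    have h3 : (∑ i ∈ S, |c i - a i| ^ p.toReal) ^ (1 / p.toReal) ≤ δ := by
      refine (Real.rpow_le_rpow (Finset.sum_nonneg fun i _ => by positivity) h2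
        (by positivity)).trans ?_
      rwa [one_div, Real.rpow_rpow_inv (lp.norm_nonneg' ξ) (zero_lt_one.trans_le hp1).ne']
    have h4 : (1 / p).toReal = 1 / p.toReal := by simp [one_div, ENNReal.toReal_inv]
    rw [h4]
    exact h1.trans (by gcongr)

/-! ### The error of the truncation method -/

theorem norm_basisDeriv_le (r : ℕ) (i : ℕ × ℕ) :
    ‖basisDeriv r i‖ ≤ 2 * (hat i.1 ^ (2 * (r : ℝ) + 1 / 2) * hat i.2 ^ (1 / 2 : ℝ)) := by
  have h1 := hat_pos i.1
  have h2 := hat_pos i.2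
  rw [ContinuousMap.norm_le _ (by positivity)]
  rintro ⟨x, hx⟩
  have hsqrt : ∀ k : ℕ, Real.sqrt ((k : ℝ) + 1 / 2) ≤ Real.sqrt 2 * hat k ^ (1 / 2 : ℝ) := by
    intro k
    rw [← Real.sqrt_eq_rpow, ← Real.sqrt_mul (by norm_num)]
    refine Real.sqrt_le_sqrt ?_
    linarith [one_le_hat k, natCast_le_hat k]
  have e1 : |(Polynomial.derivative^[r] (legendre i.1)).eval x.1| ≤
      Real.sqrt 2 * hat i.1 ^ (1 / 2 : ℝ) * hat i.1 ^ (2 * r) := by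
    refine (abs_legendre_deriv_le i.1 r hx.1).trans ?_
    gcongr
    · exact hsqrt _
    · exact natCast_le_hat _
  have e2 : |(legendre i.2).eval x.2| ≤ Real.sqrt 2 * hat i.2 ^ (1 / 2 : ℝ) := by
    refine le_trans ?_ (hsqrt _)
    simpa using abs_legendre_deriv_le i.2 0 hx.2
  have e3 : hat i.1 ^ (2 * (r : ℝ) + 1 / 2) = hat i.1 ^ (1 / 2 : ℝ) * hat i.1 ^ (2 * r) := by
    rw [← Real.rpow_natCast, ← Real.rpow_add h1]; congr 1; push_cast; ring
  rw [e3]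
  calc ‖basisDeriv r i ⟨x, hx⟩‖ = |(Polynomial.derivative^[r] (legendre i.1)).eval x.1| *
        |(legendre i.2).eval x.2| := by
        rw [Real.norm_eq_abs, ← abs_mul]; rfl
    _ ≤ (Real.sqrt 2 * hat i.1 ^ (1 / 2 : ℝ) * hat i.1 ^ (2 * r)) *
        (Real.sqrt 2 * hat i.2 ^ (1 / 2 : ℝ)) := by gcongr
    _ = (Real.sqrt 2 * Real.sqrt 2) *
        (hat i.1 ^ (1 / 2 : ℝ) * hat i.1 ^ (2 * r) * hat i.2 ^ (1 / 2 : ℝ)) := by ring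
    _ = _ := by rw [Real.mul_self_sqrt (by norm_num)]

/-- The coefficients of `f` multiplied by the weights of `‖f‖_{s,μ}`. -/
noncomputable def weightedCoeff (μ₁ μ₂ : ℝ) (f : ℝ × ℝ → ℝ) (i : ℕ × ℕ) : ℝ :=
  hat i.1 ^ μ₁ * hat i.2 ^ μ₂ * |coeff f i|

theorem weightedCoeff_nonneg (μ₁ μ₂ : ℝ) (f : ℝ × ℝ → ℝ) (i : ℕ × ℕ) :
    0 ≤ weightedCoeff μ₁ μ₂ f i := by
  have h1 := hat_pos i.1
  have h2 := hat_pos i.2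
  unfold weightedCoeff; positivity

theorem weightedCoeff_rpow (s μ₁ μ₂ : ℝ) (f : ℝ × ℝ → ℝ) (i : ℕ × ℕ) :
    weightedCoeff μ₁ μ₂ f i ^ s = normTerm s μ₁ μ₂ f i := by
  have h1 := hat_pos i.1
  have h2 := hat_pos i.2
  rw [weightedCoeff, Real.mul_rpow (by positivity) (abs_nonneg _),
    Real.mul_rpow (by positivity) (by positivity), ← Real.rpow_mul h1.le, ← Real.rpow_mul h2.le,
    mul_comm μ₁, mul_comm μ₂]
  rfl

theorem normTerm_nonneg (s μ₁ μ₂ : ℝ) (f : ℝ × ℝ → ℝ) (i : ℕ × ℕ) : 0 ≤ normTerm s μ₁ μ₂ f i := by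
  unfold normTerm; positivity

theorem sum_weightedCoeff_rpow_le_one {s μ₁ μ₂ : ℝ} (hs : 1 ≤ s) {f : ℝ × ℝ → ℝ}
    (hf : f ∈ unitBall s μ₁ μ₂) (T : Finset (ℕ × ℕ)) :
    ∑ i ∈ T, weightedCoeff μ₁ μ₂ f i ^ s ≤ 1 := by
  obtain ⟨-, hsum, hle⟩ := hf
  simp_rw [weightedCoeff_rpow]
  refine (hsum.sum_le_tsum T fun i _ => normTerm_nonneg s μ₁ μ₂ f i).trans ?_
  by_contra! hlt
  exact absurd hle (not_le.mpr (Real.one_lt_rpow hlt (by positivity)))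

theorem norm_coeff_smul_basisDeriv_le (r : ℕ) (μ₁ μ₂ : ℝ) (f : ℝ × ℝ → ℝ) (i : ℕ × ℕ) :
    ‖coeff f i • basisDeriv r i‖ ≤ 2 * (weightedCoeff μ₁ μ₂ f i *
      (hat i.1 ^ (-(μ₁ - 2 * r - 1 / 2)) * hat i.2 ^ (-(μ₂ - 1 / 2)))) := by
  have h1 := hat_pos i.1
  have h2 := hat_pos i.2
  rw [norm_smul, Real.norm_eq_abs]
  refine (mul_le_mul_of_nonneg_left (norm_basisDeriv_le r i) (abs_nonneg _)).trans_eq ?_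
  have e1 : hat i.1 ^ (2 * (r : ℝ) + 1 / 2) = hat i.1 ^ μ₁ * hat i.1 ^ (-(μ₁ - 2 * r - 1 / 2)) := by
    rw [← Real.rpow_add h1]; congr 1; ring
  have e2 : hat i.2 ^ (1 / 2 : ℝ) = hat i.2 ^ μ₂ * hat i.2 ^ (-(μ₂ - 1 / 2)) := by
    rw [← Real.rpow_add h2]; congr 1; ring
  rw [weightedCoeff, e1, e2]; ring

/-- The part of the series for `f^{(r,0)}` outside a hyperbolic cross, in the form of absolute
convergence in `C(Q)`. -/
theorem sum_norm_outside_cross_le (r : ℕ) {s μ₁ μ₂ α γ : ℝ} (hs : 1 ≤ s)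
    (hα : α = μ₁ - 2 * (r : ℝ) + 1 / s - 3 / 2) (hα0 : 0 < α)
    (hγ : γ * α < μ₂ + 1 / s - 3 / 2) :
    ∃ C > (0 : ℝ), ∀ f ∈ unitBall s μ₁ μ₂, ∀ n : ℝ, 0 < n → ∀ T : Finset (ℕ × ℕ),
      (∀ i ∈ T, n < hat i.1 * hat i.2 ^ γ) →
      ∑ i ∈ T, ‖coeff f i • basisDeriv r i‖ ≤ C * n ^ (-α) := by
  have hu : μ₁ - 2 * r - 1 / 2 - 1 + 1 / s = α := by rw [hα]; ring
  obtain ⟨C, hC, h⟩ := sum_mul_hat_rpow_outside_cross_le (u := μ₁ - 2 * r - 1 / 2)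
    (v := μ₂ - 1 / 2) (γ := γ) hs (by linarith) (by rw [hu]; linarith)
  rw [hu] at h
  refine ⟨2 * C, by positivity, fun f hf n hn T hT => ?_⟩
  calc _ ≤ ∑ i ∈ T, 2 * (weightedCoeff μ₁ μ₂ f i *
        (hat i.1 ^ (-(μ₁ - 2 * r - 1 / 2)) * hat i.2 ^ (-(μ₂ - 1 / 2)))) :=
        Finset.sum_le_sum fun i _ => norm_coeff_smul_basisDeriv_le r μ₁ μ₂ f i
    _ ≤ 2 * (C * n ^ (-α)) := by
        rw [← Finset.mul_sum]
        gcongr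
        exact h T _ n (weightedCoeff_nonneg μ₁ μ₂ f) hn hT (sum_weightedCoeff_rpow_le_one hs hf T)
    _ = _ := by ring

/-- The enumeration `m ↦ (r + m.1, m.2)` of the indices of the series for `f^{(r,0)}`. -/
def shiftEmbedding (r : ℕ) : ℕ × ℕ ↪ ℕ × ℕ :=
  ⟨fun m => (r + m.1, m.2), fun m m' h => by
    simp only [Prod.mk.injEq, Nat.add_left_cancel_iff] at h
    exact Prod.ext h.1 h.2⟩

theorem summable_derivTerm {r : ℕ} {f : ℝ × ℝ → ℝ} {B : ℝ}
    (hB : ∀ T : Finset (ℕ × ℕ), ∑ i ∈ T, ‖coeff f i • basisDeriv r i‖ ≤ B) :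
    Summable (derivTerm r f) := by
  refine Summable.of_norm (summable_of_sum_le (fun _ => norm_nonneg _) (c := B) fun T => ?_)
  refine le_trans (le_of_eq ?_) (hB (T.map (shiftEmbedding r)))
  rw [Finset.sum_map]; rfl

theorem truncation_coe (r : ℕ) (G : Finset (ℕ × ℕ)) (c : ℕ × ℕ → ℝ) :
    truncation r G (fun i => c i) = ∑ i ∈ G, c i • basisDeriv r i :=
  Finset.sum_coe_sort G fun i => c i • basisDeriv r i

/-- With exact coefficients, the error of the truncation method on `G` is at most a common bound of
the sums of norms outside `G`. -/
theorem norm_partialDeriv_sub_truncation_le {r : ℕ} {f : ℝ × ℝ → ℝ} (hf : Summable (derivTerm r f))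
    {G : Finset (ℕ × ℕ)} (hG : ∀ i ∈ G, r ≤ i.1) {B : ℝ}
    (hB : ∀ T : Finset (ℕ × ℕ), (∀ i ∈ T, r ≤ i.1 ∧ i ∉ G) →
      ∑ i ∈ T, ‖coeff f i • basisDeriv r i‖ ≤ B) :
    ‖partialDeriv r f - truncation r G (fun i => coeff f i)‖ ≤ B := by
  classical
  set G' := G.preimage (shiftEmbedding r) (shiftEmbedding r).injective.injOn with hG'
  have hmap : G'.map (shiftEmbedding r) = G := by
    ext i
    simp only [hG', Finset.mem_map, Finset.mem_preimage]
    constructor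
    · rintro ⟨m, hm, rfl⟩; exact hm
    · intro hi
      have : shiftEmbedding r (i.1 - r, i.2) = i :=
        Prod.ext (Nat.add_sub_cancel' (hG i hi)) rfl
      exact ⟨(i.1 - r, i.2), by rwa [this], this⟩
  have htr : truncation r G (fun i => coeff f i) = ∑ m ∈ G', derivTerm r f m := by
    rw [truncation_coe, ← hmap, Finset.sum_map]; rfl
  have hlim : Filter.Tendsto
      (fun T : Finset (ℕ × ℕ) => ‖∑ m ∈ T, derivTerm r f m - ∑ m ∈ G', derivTerm r f m‖)
      Filter.atTop (nhds ‖partialDeriv r f - ∑ m ∈ G', derivTerm r f m‖) :=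
    (hf.hasSum.sub_const _).norm
  rw [htr]
  refine le_of_tendsto hlim ?_
  filter_upwards [Filter.eventually_ge_atTop G'] with T hT
  rw [← Finset.sum_sdiff hT, add_sub_cancel_right]
  refine (norm_sum_le _ _).trans ((le_of_eq ?_).trans (hB ((T \ G').map (shiftEmbedding r)) ?_))
  · rw [Finset.sum_map]; rfl
  · intro i hi
    obtain ⟨m, hm, rfl⟩ := Finset.mem_map.mp hi
    exact ⟨Nat.le_add_right _ _, fun h => (Finset.mem_sdiff.mp hm).2 (Finset.mem_preimage.mpr h)⟩

/-- In terms of `hat`, the bounds `k ≤ n` and `j ≤ (n/r)^{1/γ}` in the definition of the cross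
follow from the single condition on the product. -/
theorem mem_hyperbolicCross {r n : ℕ} (hr : 1 ≤ r) {γ : ℝ} (hγ : 0 < γ) {i : ℕ × ℕ} :
    i ∈ hyperbolicCross r n γ ↔ r ≤ i.1 ∧ hat i.1 * hat i.2 ^ γ ≤ n := by
  obtain ⟨k, j⟩ := i
  simp only [hyperbolicCross, Finset.mem_filter, Finset.mem_product, Finset.mem_Icc, zero_le,
    true_and]
  have hj := hat_pos j
  constructor
  · rintro ⟨⟨⟨hk, hkn⟩, -⟩, h⟩
    refine ⟨hk, ?_⟩
    rw [hat_of_pos (hr.trans hk)]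
    rcases Nat.eq_zero_or_pos j with rfl | hj0
    · simpa [hat_zero] using hkn
    · rwa [hat_of_pos hj0]
  · rintro ⟨hk, h⟩
    have hr0 : (0 : ℝ) < r := by exact_mod_cast hr
    have hrk : (r : ℝ) ≤ k := by exact_mod_cast hk
    rw [hat_of_pos (hr.trans hk)] at h
    have h1 : (1 : ℝ) ≤ hat j ^ γ := Real.one_le_rpow (one_le_hat j) hγ.le
    refine ⟨⟨⟨hk, ?_⟩, ?_⟩, ?_⟩
    · have : (k : ℝ) ≤ n := by nlinarith
      exact_mod_cast this
    · refine Nat.le_floor ((natCast_le_hat j).trans ?_)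
      have : hat j ^ γ ≤ n / r := by
        rw [le_div_iff₀ hr0]; nlinarith
      have := Real.rpow_le_rpow (by positivity) this (by positivity : 0 ≤ 1 / γ)
      rwa [one_div, Real.rpow_rpow_inv hj.le hγ.ne', ← one_div] at this
    · refine le_trans ?_ h
      gcongr
      exact natCast_le_hat j

theorem algError_le_of_forall {r : ℕ} {s μ₁ μ₂ : ℝ} {p : ℝ≥0∞} {δ : ℝ} {Ω : Finset (ℕ × ℕ)}
    {ψ : (Ω → ℝ) → C(square, ℝ)} {B : ℝ}
    (h : ∀ f ∈ unitBall s μ₁ μ₂, ∀ a, IsPerturbation p δ (coeff f) a →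
      ‖partialDeriv r f - ψ (fun i => a i)‖ ≤ B) :
    algError r s μ₁ μ₂ p δ Ω ψ ≤ ENNReal.ofReal B := by
  refine iSup₂_le fun f hf => iSup₂_le fun a ha => ?_
  rw [← ofReal_norm]
  exact ENNReal.ofReal_le_ofReal (h f hf a ha)

theorem summable_and_norm_partialDeriv_le (r : ℕ) {s μ₁ μ₂ α : ℝ} (hs : 1 ≤ s)
    (hα : α = μ₁ - 2 * (r : ℝ) + 1 / s - 3 / 2) (hα0 : 0 < α) (hμ : α < μ₂ + 1 / s - 3 / 2) :
    ∃ C > (0 : ℝ), ∀ f ∈ unitBall s μ₁ μ₂,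
      Summable (derivTerm r f) ∧ ‖partialDeriv r f‖ ≤ C := by
  obtain ⟨C, hC, h⟩ := sum_norm_outside_cross_le r (μ₂ := μ₂) (γ := 1) hs hα hα0 (by linarith)
  refine ⟨C * (1 / 2) ^ (-α), by positivity, fun f hf => ?_⟩
  have hB : ∀ T : Finset (ℕ × ℕ), ∑ i ∈ T, ‖coeff f i • basisDeriv r i‖ ≤ C * (1 / 2) ^ (-α) :=
    -- for `n = 1/2` the cross is empty
    fun T => h f hf (1 / 2) (by norm_num) T fun i _ => by
      rw [Real.rpow_one]
      nlinarith [one_le_hat i.1, one_le_hat i.2]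
  have hsum := summable_derivTerm hB
  refine ⟨hsum, ?_⟩
  have := norm_partialDeriv_sub_truncation_le hsum (G := ∅) (by simp) fun T _ => hB T
  simpa [truncation] using this

/-- The upper bound for the truncation method: the coefficients left out contribute `n ^ (-α)`, the
noise `δ n ^ (β - α)`. -/
theorem crossError_le {r : ℕ} (hr : 1 ≤ r) {s μ₁ μ₂ α β γ : ℝ} (hs : 1 ≤ s) {p : ℝ≥0∞} (hp : 1 ≤ p)
    (hα : α = μ₁ - 2 * (r : ℝ) + 1 / s - 3 / 2) (hα0 : 0 < α)
    (hβ : β = μ₁ - (1 / p).toReal + 1 / s) (hμ : α < μ₂ + 1 / s - 3 / 2) (hγ1 : 1 ≤ γ)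
    (hγ : γ * α < μ₂ + 1 / s - 3 / 2) :
    ∃ C > (0 : ℝ), ∀ n : ℕ, 1 ≤ n → ∀ δ : ℝ, 0 ≤ δ →
      crossError r s μ₁ μ₂ p δ n γ ≤
        ENNReal.ofReal (C * ((n : ℝ) ^ (-α) + δ * (n : ℝ) ^ (β - α))) := by
  obtain ⟨hp0, hp1⟩ := toReal_one_div_mem hp
  have hr1 : (1 : ℝ) ≤ r := by exact_mod_cast hr
  obtain ⟨C₀, -, h0⟩ := summable_and_norm_partialDeriv_le r hs hα hα0 hμ
  obtain ⟨C₁, hC₁, h1⟩ := sum_norm_outside_cross_le r hs hα hα0 hγ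
  obtain ⟨C₂, hC₂, h2⟩ := sum_mul_hat_rpow_cross_le (e := 2 * (r : ℝ) + 1 / 2)
    (κ := 1 - (1 / p).toReal) (γ := γ) (by linarith) (by linarith) (by linarith) hγ1
  have hexp : 2 * (r : ℝ) + 1 / 2 + (1 - (1 / p).toReal) = β - α := by rw [hα, hβ]; ring
  rw [hexp] at h2
  refine ⟨C₁ + 2 * C₂, by positivity, fun n hn δ hδ => algError_le_of_forall fun f hf a ha => ?_⟩
  have hn0 : (0 : ℝ) < n := by exact_mod_cast hn
  have hmem := fun i => mem_hyperbolicCross (r := r) (n := n) hr (γ := γ) (by linarith) (i := i)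
  have e1 : ‖partialDeriv r f - truncation r (hyperbolicCross r n γ) (fun i => coeff f i)‖ ≤
      C₁ * (n : ℝ) ^ (-α) :=
    norm_partialDeriv_sub_truncation_le (h0 f hf).1 (fun i hi => ((hmem i).mp hi).1)
      fun T hT => h1 f hf n hn0 T fun i hi => by
        obtain ⟨hri, hi'⟩ := hT i hi
        by_contra! hle
        exact hi' ((hmem i).mpr ⟨hri, hle⟩)
  have e2 : ‖truncation r (hyperbolicCross r n γ) (fun i => coeff f i) -
      truncation r (hyperbolicCross r n γ) (fun i => a i)‖ ≤
      2 * (C₂ * (δ * (n : ℝ) ^ (β - α))) := by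
    rw [truncation_coe, truncation_coe, ← Finset.sum_sub_distrib]
    calc _ ≤ ∑ i ∈ hyperbolicCross r n γ, 2 * (|coeff f i - a i| *
          (hat i.1 ^ (2 * (r : ℝ) + 1 / 2) * hat i.2 ^ (1 / 2 : ℝ))) := by
          refine (norm_sum_le _ _).trans (Finset.sum_le_sum fun i _ => ?_)
          rw [← sub_smul, norm_smul, Real.norm_eq_abs]
          refine (mul_le_mul_of_nonneg_left (norm_basisDeriv_le r i) (abs_nonneg _)).trans_eq ?_
          ring
      _ ≤ _ := by
          rw [← Finset.mul_sum]
          gcongr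
          exact h2 _ (fun i => coeff f i - a i) n δ hn0 hδ (fun S => ha.sum_abs_le hp S)
            fun i hi => ((hmem i).mp hi).2
  have hP1 : 0 ≤ (n : ℝ) ^ (-α) := by positivity
  have hP2 : 0 ≤ δ * (n : ℝ) ^ (β - α) := by positivity
  calc _ ≤ _ := norm_sub_le_norm_sub_add_norm_sub _
        (truncation r (hyperbolicCross r n γ) (fun i => coeff f i)) _
    _ ≤ C₁ * (n : ℝ) ^ (-α) + 2 * (C₂ * (δ * (n : ℝ) ^ (β - α))) := add_le_add e1 e2
    _ ≤ _ := by nlinarith [mul_nonneg hC₁.le hP2, mul_nonneg hC₂.le hP1]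

/-! ### The lower bound for the minimal radius -/

theorem isPerturbation_self (p : ℝ≥0∞) {δ : ℝ} (hδ : 0 ≤ δ) (c : ℕ × ℕ → ℝ) :
    IsPerturbation p δ c c := by
  have h0 : (fun i => c i - c i) = (0 : ℕ × ℕ → ℝ) := by ext i; simp
  refine ⟨by rw [h0]; exact zero_memℓp, ?_⟩
  have : (⟨fun i => c i - c i, by rw [h0]; exact zero_memℓp⟩ : lp (fun _ : ℕ × ℕ => ℝ) p) = 0 :=
    Subtype.ext h0
  rw [this, lp.norm_zero]
  exact hδ

/-- Two functions with the same information are at most two errors apart. -/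
theorem enorm_partialDeriv_sub_le {r : ℕ} {s μ₁ μ₂ : ℝ} {p : ℝ≥0∞} {δ : ℝ} (hδ : 0 ≤ δ)
    {Ω : Finset (ℕ × ℕ)} (ψ : (Ω → ℝ) → C(square, ℝ)) {f g : ℝ × ℝ → ℝ}
    (hf : f ∈ unitBall s μ₁ μ₂) (hg : g ∈ unitBall s μ₁ μ₂) (h : ∀ i ∈ Ω, coeff f i = coeff g i) :
    ‖partialDeriv r f - partialDeriv r g‖ₑ ≤ 2 * algError r s μ₁ μ₂ p δ Ω ψ := by
  have key : ∀ f' ∈ unitBall s μ₁ μ₂, ‖partialDeriv r f' - ψ (fun i => coeff f' i)‖ₑ ≤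
      algError r s μ₁ μ₂ p δ Ω ψ := fun f' hf' =>
    le_iSup₂_of_le f' hf' (le_iSup₂_of_le (coeff f') (isPerturbation_self p hδ _) le_rfl)
  have hfg : (fun i : Ω => coeff f i) = fun i : Ω => coeff g i := by
    ext i; exact h i i.2
  have e1 := key f hf
  have e2 := key g hg
  rw [← hfg] at e2
  calc ‖partialDeriv r f - partialDeriv r g‖ₑ
      = ‖(partialDeriv r f - ψ (fun i => coeff f i)) -
          (partialDeriv r g - ψ (fun i => coeff f i))‖ₑ := by rw [sub_sub_sub_cancel_right]
    _ ≤ _ := enorm_sub_le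
    _ ≤ _ := by rw [two_mul]; exact add_le_add e1 e2

theorem testFun_mem_unitBall {s μ₁ μ₂ : ℝ} (hs : 1 ≤ s) {S : Finset ℕ} {c : ℝ}
    (h : ∑ k ∈ S, (hat k ^ μ₁ * |c|) ^ s ≤ 1) : testFun S c ∈ unitBall s μ₁ μ₂ := by
  classical
  have hz : ∀ i ∉ S ×ˢ {0}, normTerm s μ₁ μ₂ (testFun S c) i = 0 := by
    intro i hi
    rw [normTerm, coeff_testFun, if_neg, abs_zero, Real.zero_rpow (by linarith), mul_zero]
    rwa [Finset.mem_product, Finset.mem_singleton] at hi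
  have hsum : ∑ i ∈ S ×ˢ {0}, normTerm s μ₁ μ₂ (testFun S c) i =
      ∑ k ∈ S, (hat k ^ μ₁ * |c|) ^ s := by
    rw [Finset.sum_product]
    refine Finset.sum_congr rfl fun k hk => ?_
    rw [Finset.sum_singleton, ← weightedCoeff_rpow, weightedCoeff, coeff_testFun, if_pos ⟨hk, rfl⟩,
      hat_zero, Real.one_rpow, mul_one]
  refine ⟨memLp_testFun S c, (hasSum_sum_of_ne_finset_zero hz).summable, ?_⟩
  rw [tsum_eq_sum hz, hsum]
  refine Real.rpow_le_one (Finset.sum_nonneg fun k _ => ?_) h (by positivity)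
  have := hat_pos k
  positivity

theorem partialDeriv_testFun {r : ℕ} {S : Finset ℕ} (hS : ∀ k ∈ S, r ≤ k) (c : ℝ) :
    partialDeriv r (testFun S c) = c • ∑ k ∈ S, basisDeriv r (k, 0) := by
  classical
  have hzero : ∀ i ∉ S ×ˢ {0}, coeff (testFun S c) i = 0 := by
    intro i hi
    rw [coeff_testFun, if_neg]
    rwa [Finset.mem_product, Finset.mem_singleton] at hi
  have hsum : Summable (derivTerm r (testFun S c)) := by
    refine summable_derivTerm (B := ∑ i ∈ S ×ˢ {0}, ‖coeff (testFun S c) i • basisDeriv r i‖)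
      fun T => ?_
    rw [← Finset.sum_filter_add_sum_filter_not T (fun i => i ∈ S ×ˢ {0}),
      Finset.sum_eq_zero (s := T.filter (fun i => ¬ i ∈ S ×ˢ {0})), add_zero]
    · exact Finset.sum_le_sum_of_subset_of_nonneg (fun i hi => (Finset.mem_filter.mp hi).2)
        fun _ _ _ => norm_nonneg _
    · intro i hi
      rw [hzero i (Finset.mem_filter.mp hi).2, zero_smul, norm_zero]
  have h := norm_partialDeriv_sub_truncation_le hsum (G := S ×ˢ {0}) (B := 0)
    (fun i hi => hS _ (Finset.mem_product.mp hi).1) fun T hT =>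
      (Finset.sum_eq_zero fun i hi => by
        rw [hzero i (hT i hi).2, zero_smul, norm_zero]).le
  rw [sub_eq_zero.mp (norm_le_zero_iff.mp h), truncation_coe, Finset.sum_product, Finset.smul_sum]
  refine Finset.sum_congr rfl fun k hk => ?_
  rw [Finset.sum_singleton, coeff_testFun, if_pos ⟨hk, rfl⟩]

/-- The derivatives `φ_k^{(r)}` are all positive and large at `1`, so their values add up there. -/
theorem le_norm_sum_basisDeriv (r : ℕ) : ∃ c > (0 : ℝ), ∀ (M : ℕ) (S : Finset ℕ), r ≤ M →
    M ≤ S.card → (∀ k ∈ S, 2 * M ≤ k) →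
    c * (M : ℝ) ^ (2 * (r : ℝ) + 3 / 2) ≤ ‖∑ k ∈ S, basisDeriv r (k, 0)‖ := by
  obtain ⟨c, hc, h⟩ := le_legendre_deriv_one r
  refine ⟨c, hc, fun M S hM hcard hS => ?_⟩
  have hx : ((1, 1) : ℝ × ℝ) ∈ square := by simp [square]
  have heval : (∑ k ∈ S, basisDeriv r (k, 0)) ⟨(1, 1), hx⟩ =
      ∑ k ∈ S, (Polynomial.derivative^[r] (legendre k)).eval 1 * Real.sqrt (1 / 2) := by
    rw [ContinuousMap.sum_apply]
    refine Finset.sum_congr rfl fun k _ => ?_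
    have := legendre_eval_endpoint 0 (one_pow 2)
    simp only [pow_zero, Nat.cast_zero, zero_add, one_mul] at this
    rw [← this]; rfl
  have hterm : ∀ k ∈ S, c * (M : ℝ) ^ (2 * (r : ℝ) + 1 / 2) ≤
      (Polynomial.derivative^[r] (legendre k)).eval 1 * Real.sqrt (1 / 2) := by
    intro k hk
    have hk2 : 2 * (M : ℝ) ≤ k := by exact_mod_cast hS k hk
    have hM0 : (0 : ℝ) ≤ M := by positivity
    have h1 := h k (by have := hS k hk; omega)
    refine le_trans ?_ (mul_le_mul_of_nonneg_right h1 (Real.sqrt_nonneg _))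
    have e1 : (M : ℝ) ^ (2 * (r : ℝ) + 1 / 2) = (M : ℝ) ^ (2 * r) * Real.sqrt M := by
      rw [Real.rpow_add_of_nonneg hM0 (by positivity) (by norm_num), Real.sqrt_eq_rpow,
        ← Real.rpow_natCast]
      push_cast; rfl
    have e2 : Real.sqrt M ≤ Real.sqrt ((k : ℝ) + 1 / 2) * Real.sqrt (1 / 2) := by
      rw [← Real.sqrt_mul (by positivity)]
      exact Real.sqrt_le_sqrt (by linarith)
    calc c * (M : ℝ) ^ (2 * (r : ℝ) + 1 / 2) = c * ((M : ℝ) ^ (2 * r) * Real.sqrt M) := by rw [e1]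
      _ ≤ c * ((k : ℝ) ^ (2 * r) * (Real.sqrt ((k : ℝ) + 1 / 2) * Real.sqrt (1 / 2))) := by
          gcongr
          have := hS k hk
          omega
      _ = _ := by ring
  have hsum : c * (M : ℝ) ^ (2 * (r : ℝ) + 3 / 2) ≤
      (∑ k ∈ S, basisDeriv r (k, 0)) ⟨(1, 1), hx⟩ := by
    rw [heval]
    calc c * (M : ℝ) ^ (2 * (r : ℝ) + 3 / 2) = M * (c * (M : ℝ) ^ (2 * (r : ℝ) + 1 / 2)) := by
          have : 2 * (r : ℝ) + 3 / 2 = 1 + (2 * (r : ℝ) + 1 / 2) := by ring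
          rw [this, Real.rpow_add_of_nonneg (by positivity) (by norm_num) (by positivity),
            Real.rpow_one]
          ring
      _ ≤ S.card * (c * (M : ℝ) ^ (2 * (r : ℝ) + 1 / 2)) := by
          gcongr
      _ = S.card • (c * (M : ℝ) ^ (2 * (r : ℝ) + 1 / 2)) := by rw [nsmul_eq_mul]
      _ ≤ _ := Finset.card_nsmul_le_sum _ _ _ hterm
  have hnorm := ContinuousMap.norm_coe_le_norm (∑ k ∈ S, basisDeriv r (k, 0)) ⟨(1, 1), hx⟩
  rw [Real.norm_eq_abs] at hnorm
  exact hsum.trans ((le_abs_self _).trans hnorm)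

/-- The lower bound for the minimal radius. Among the `2 M` indices `(k, 0)` with `2 M ≤ k < 4 M`,
where `M = r N`, at least `M` are outside `Ω`; a function `f` supported there and its negative `-f`
have zero information. -/
theorem le_minRadius {r : ℕ} (hr : 1 ≤ r) {s μ₁ μ₂ α : ℝ} (hs : 1 ≤ s) (p : ℝ≥0∞)
    (hα : α = μ₁ - 2 * (r : ℝ) + 1 / s - 3 / 2) (hμ₁ : 0 ≤ μ₁) :
    ∃ c > (0 : ℝ), ∀ N : ℕ, 1 ≤ N → ∀ δ : ℝ, 0 ≤ δ →
      ENNReal.ofReal (c * (N : ℝ) ^ (-α)) ≤ minRadius r s μ₁ μ₂ p δ N := by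
  classical
  obtain ⟨c, hc, h⟩ := le_norm_sum_basisDeriv r
  have hr0 : (0 : ℝ) < r := by exact_mod_cast hr
  refine ⟨c * 4 ^ (-μ₁) * 2 ^ (-(1 / s)) * (r : ℝ) ^ (-α), by positivity, fun N hN δ hδ => ?_⟩
  refine le_iInf₂ fun Ω hΩ => le_iInf fun ψ => ?_
  obtain ⟨hΩr, hΩc⟩ := hΩ
  have hN0 : (0 : ℝ) < N := by exact_mod_cast hN
  set M := r * N with hM
  have hrM : r ≤ M := Nat.le_mul_of_pos_right r hN
  have hNM : N ≤ M := Nat.le_mul_of_pos_left N hr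
  have hM0 : (0 : ℝ) < M := by exact_mod_cast hr.trans hrM
  set S := (Finset.Ico (2 * M) (4 * M)).filter (fun k => (k, 0) ∉ Ω) with hS
  have hScard : M ≤ S.card := by
    have h1 : S.card + ((Finset.Ico (2 * M) (4 * M)).filter (fun k => ¬ (k, 0) ∉ Ω)).card =
        (Finset.Ico (2 * M) (4 * M)).card := Finset.card_filter_add_card_filter_not _
    have h2 : ((Finset.Ico (2 * M) (4 * M)).filter (fun k => ¬ (k, 0) ∉ Ω)).card ≤ Ω.card := by
      refine Finset.card_le_card_of_injOn (fun k => (k, 0)) (fun k hk => ?_) (fun a _ b _ hab => ?_)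
      · exact not_not.mp (Finset.mem_filter.mp hk).2
      · exact (Prod.mk.inj hab).1
    rw [Nat.card_Ico] at h1
    omega
  have hSk : ∀ k ∈ S, 2 * M ≤ k ∧ k < 4 * M ∧ (k, 0) ∉ Ω := fun k hk => by
    have := Finset.mem_filter.mp hk
    rw [Finset.mem_Ico] at this
    exact ⟨this.1.1, this.1.2, this.2⟩
  -- with coefficients `±b` the at most `2 M` indices `k < 4 M` give a function of norm at most `1`
  set b : ℝ := (4 * (M : ℝ)) ^ (-μ₁) * (2 * (M : ℝ)) ^ (-(1 / s)) with hb
  have hb0 : 0 < b := by positivity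
  have hball : ∀ b', |b'| = b → testFun S b' ∈ unitBall s μ₁ μ₂ := by
    intro b' hb'
    refine testFun_mem_unitBall hs ?_
    rw [hb']
    have hterm : ∀ k ∈ S, (hat k ^ μ₁ * b) ^ s ≤ (2 * (M : ℝ))⁻¹ := by
      intro k hk
      obtain ⟨hk1, hk2, -⟩ := hSk k hk
      have hk' : hat k ≤ 4 * M := by
        rw [hat_of_pos (by omega)]; exact_mod_cast hk2.le
      have h0 := hat_pos k
      have : hat k ^ μ₁ * b ≤ (2 * (M : ℝ)) ^ (-(1 / s)) := by
        calc hat k ^ μ₁ * b ≤ (4 * (M : ℝ)) ^ μ₁ * b := by gcongr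
          _ = _ := by
            rw [hb, ← mul_assoc, ← Real.rpow_add (by positivity), add_neg_cancel, Real.rpow_zero,
              one_mul]
      refine (Real.rpow_le_rpow (by positivity) this (by linarith)).trans_eq ?_
      rw [← Real.rpow_mul (by positivity), neg_mul, one_div_mul_cancel (by linarith),
        Real.rpow_neg_one]
    have hcard : S.card ≤ 2 * M := by
      refine (Finset.card_filter_le _ _).trans ?_
      rw [Nat.card_Ico]; omega
    have hcard' : (S.card : ℝ) ≤ 2 * M := by exact_mod_cast hcard
    refine (Finset.sum_le_card_nsmul _ _ _ hterm).trans ?_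
    rw [nsmul_eq_mul, ← div_eq_mul_inv, div_le_one (by positivity)]
    exact hcard'
  have hcoeff : ∀ b', ∀ i ∈ Ω, coeff (testFun S b') i = 0 := by
    intro b' i hi
    rw [coeff_testFun, if_neg]
    rintro ⟨h1, h2⟩
    exact (hSk i.1 h1).2.2 (by rwa [← h2])
  have hSr : ∀ k ∈ S, r ≤ k := fun k hk => by have := (hSk k hk).1; omega
  have hle := enorm_partialDeriv_sub_le (r := r) (p := p) hδ ψ (hball b (abs_of_pos hb0))
    (hball (-b) (by rw [abs_neg, abs_of_pos hb0]))
    (fun i hi => by rw [hcoeff _ i hi, hcoeff _ i hi])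
  rw [partialDeriv_testFun hSr, partialDeriv_testFun hSr, ← sub_smul, ← ofReal_norm, norm_smul,
    sub_neg_eq_add, Real.norm_of_nonneg (by positivity), ← two_mul, mul_assoc,
    ENNReal.ofReal_mul (by norm_num), ENNReal.ofReal_ofNat,
    ENNReal.mul_le_mul_iff_right (by norm_num) (by norm_num)] at hle
  refine le_trans (ENNReal.ofReal_le_ofReal ?_) hle
  refine le_trans (le_of_eq ?_) (mul_le_mul_of_nonneg_left (h M S hrM hScard fun k hk =>
    (hSk k hk).1) hb0.le)
  have e1 : (r : ℝ) ^ (-α) * (N : ℝ) ^ (-α) =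
      (M : ℝ) ^ (-μ₁) * (M : ℝ) ^ (-(1 / s)) * (M : ℝ) ^ (2 * (r : ℝ) + 3 / 2) := by
    rw [← Real.mul_rpow hr0.le hN0.le, ← Real.rpow_add hM0, ← Real.rpow_add hM0, hM]
    push_cast; congr 1; rw [hα]; ring
  rw [hb, Real.mul_rpow (by norm_num) hM0.le, Real.mul_rpow (by norm_num) hM0.le]
  linear_combination (c * 4 ^ (-μ₁) * 2 ^ (-(1 / s))) * e1

/-! ### The number of points of a hyperbolic cross -/

/-- The points `(k, 0)`, `r ≤ k ≤ n`, alone give this bound. -/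
theorem le_mul_card_hyperbolicCross {r n : ℕ} (hr : 1 ≤ r) (hn : r ≤ n) {γ : ℝ} (hγ : 0 < γ) :
    n ≤ r * (hyperbolicCross r n γ).card := by
  have h : (Finset.Icc r n).card ≤ (hyperbolicCross r n γ).card := by
    refine Finset.card_le_card_of_injOn (fun k => (k, 0)) (fun k hk => ?_)
      (fun a _ b _ hab => (Prod.mk.inj hab).1)
    obtain ⟨h1, h2⟩ := Finset.mem_Icc.mp hk
    refine (mem_hyperbolicCross hr hγ).mpr ⟨h1, ?_⟩
    rw [hat_zero, Real.one_rpow, mul_one, hat_of_pos (hr.trans h1)]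
    exact_mod_cast h2
  rw [Nat.card_Icc] at h
  obtain ⟨d, rfl⟩ := Nat.exists_eq_add_of_le hn
  have : r * (d + 1) ≤ r * (hyperbolicCross r (r + d) γ).card := Nat.mul_le_mul_left r (by omega)
  nlinarith

theorem card_hyperbolicCross_le_sum {r : ℕ} (hr : 1 ≤ r) (n : ℕ) {γ : ℝ} (hγ : 1 ≤ γ) :
    ((hyperbolicCross r n γ).card : ℝ) ≤
      2 * n * ∑ j ∈ Finset.range (n + 1), hat j ^ (-γ) := by
  classical
  have hmem := fun i => mem_hyperbolicCross (r := r) (n := n) hr (γ := γ) (by linarith) (i := i)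
  have hmaps : ∀ i ∈ hyperbolicCross r n γ, i.2 ∈ Finset.range (n + 1) := by
    intro i hi
    obtain ⟨-, h⟩ := (hmem i).mp hi
    have h1 : hat i.2 ≤ hat i.2 ^ γ := Real.self_le_rpow_of_one_le (one_le_hat _) hγ
    have h2 : (i.2 : ℝ) ≤ n := by
      nlinarith [one_le_hat i.1, one_le_hat i.2, natCast_le_hat i.2]
    rw [Finset.mem_range, Nat.lt_succ_iff]
    exact_mod_cast h2
  rw [Finset.card_eq_sum_card_fiberwise hmaps, Nat.cast_sum, Finset.mul_sum]
  refine Finset.sum_le_sum fun j _ => ?_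
  have hj := hat_pos j
  have := card_le_of_hat_le (S := (hyperbolicCross r n γ).filter (fun i => i.2 = j))
    (g := Prod.fst) (fun i hi i' hi' h => Prod.ext h (by
      rw [(Finset.mem_filter.mp hi).2, (Finset.mem_filter.mp hi').2])) (y := n / hat j ^ γ)
    (by positivity) (fun i hi => by
      obtain ⟨hiT, hij⟩ := Finset.mem_filter.mp hi
      rw [le_div_iff₀ (by positivity), ← hij]; exact ((hmem i).mp hiT).2)
  refine this.trans_eq ?_
  rw [Real.rpow_neg hj.le]; ring

theorem card_hyperbolicCross_le {r : ℕ} (hr : 1 ≤ r) {γ : ℝ} (hγ : 1 < γ) :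
    ∃ C > (0 : ℝ), ∀ n : ℕ, ((hyperbolicCross r n γ).card : ℝ) ≤ C * n := by
  have hsum : Summable fun j => hat j ^ (-γ) := summable_hat_rpow_neg hγ
  have hterm : ∀ j, 0 < hat j ^ (-γ) := fun j => Real.rpow_pos_of_pos (hat_pos j) _
  have hZ := hsum.tsum_pos (fun j => (hterm j).le) 0 (hterm 0)
  refine ⟨2 * ∑' j, hat j ^ (-γ), by positivity, fun n => ?_⟩
  refine (card_hyperbolicCross_le_sum hr n hγ.le).trans ?_
  rw [mul_right_comm]
  gcongr
  exact hsum.sum_le_tsum _ fun j _ => (hterm j).le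

theorem card_hyperbolicCross_one_le {r : ℕ} (hr : 1 ≤ r) (n : ℕ) :
    ((hyperbolicCross r n 1).card : ℝ) ≤ 2 * n * (2 + Real.log n) := by
  refine (card_hyperbolicCross_le_sum hr n le_rfl).trans ?_
  gcongr
  rw [Finset.sum_range_succ', hat_zero, Real.one_rpow]
  have : ∑ j ∈ Finset.range n, hat (j + 1) ^ (-1 : ℝ) = (harmonic n : ℝ) := by
    rw [harmonic]; push_cast
    refine Finset.sum_congr rfl fun j _ => ?_
    rw [hat_of_pos (by omega), Real.rpow_neg_one]; push_cast; rfl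
  rw [this]
  linarith [harmonic_le_one_add_log n]

/-- The row `j ≤ n/r` has `⌊n/j⌋ + 1 - r ≥ ⌊n/j⌋ / r ≥ n / (2 j r)` points, and the sum over `j` is
harmonic. -/
theorem mul_log_le_card_hyperbolicCross_one {r n : ℕ} (hr : 1 ≤ r) (hn : r ≤ n) :
    (n : ℝ) * Real.log (n / r) ≤ 2 * r * (hyperbolicCross r n 1).card := by
  have hr0 : (0 : ℝ) < r := by exact_mod_cast hr
  have hn0 : (0 : ℝ) < n := by exact_mod_cast hr.trans hn
  -- `j + 1` with `j` in `Finset.range (n / r)` enumerates the rows `1, …, ⌊n/r⌋`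
  have hcard : ∑ j ∈ Finset.range (n / r), (n / (j + 1) + 1 - r) ≤
      (hyperbolicCross r n 1).card := by
    have : (((Finset.range (n / r)).sigma fun j => Finset.Icc r (n / (j + 1)))).card =
        ∑ j ∈ Finset.range (n / r), (n / (j + 1) + 1 - r) := by
      rw [Finset.card_sigma]
      exact Finset.sum_congr rfl fun j _ => Nat.card_Icc _ _
    rw [← this]
    refine Finset.card_le_card_of_injOn (fun x => (x.2, x.1 + 1)) (fun x hx => ?_)
      (fun x _ y _ hxy => ?_)
    · obtain ⟨j, k⟩ := x
      obtain ⟨-, hk⟩ := Finset.mem_sigma.mp hx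
      obtain ⟨hk1, hk2⟩ := Finset.mem_Icc.mp hk
      refine (mem_hyperbolicCross hr one_pos).mpr ⟨hk1, ?_⟩
      change hat k * hat (j + 1) ^ (1 : ℝ) ≤ n
      rw [Real.rpow_one, hat_of_pos (hr.trans hk1), hat_of_pos (Nat.le_add_left 1 j)]
      exact_mod_cast (Nat.le_div_iff_mul_le (by omega)).mp hk2
    · obtain ⟨j, k⟩ := x
      obtain ⟨j', k'⟩ := y
      simp only [Prod.mk.injEq, Nat.add_right_cancel_iff] at hxy
      rw [hxy.1, hxy.2]
  have hterm : ∀ j ∈ Finset.range (n / r),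
      (n : ℝ) * ((j + 1 : ℕ) : ℝ)⁻¹ ≤ 2 * r * ((n / (j + 1) + 1 - r : ℕ) : ℝ) := by
    intro j hj
    have hj1 : (j + 1) * r ≤ n := by
      have := (Nat.le_div_iff_mul_le (by omega)).mp (Finset.mem_range.mp hj)
      simpa using this
    have hq : r ≤ n / (j + 1) := (Nat.le_div_iff_mul_le (by omega)).mpr (by linarith)
    have h1 : n < (j + 1) * (n / (j + 1) + 1) := Nat.lt_mul_div_succ n (by omega)
    have h2 : n / (j + 1) ≤ r * (n / (j + 1) + 1 - r) := by
      obtain ⟨d, hd⟩ := Nat.exists_eq_add_of_le hq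
      rw [hd, show r + d + 1 - r = d + 1 by omega]
      nlinarith
    have h3 : n ≤ 2 * r * (n / (j + 1) + 1 - r) * (j + 1) := by
      have h4 : n / (j + 1) + 1 ≤ 2 * (r * (n / (j + 1) + 1 - r)) := by omega
      calc n ≤ (j + 1) * (n / (j + 1) + 1) := h1.le
        _ ≤ (j + 1) * (2 * (r * (n / (j + 1) + 1 - r))) := Nat.mul_le_mul_left _ h4
        _ = _ := by ring
    rw [← div_eq_mul_inv, div_le_iff₀ (by positivity)]
    exact_mod_cast h3
  have hlog : Real.log (n / r) ≤ (harmonic (n / r) : ℝ) := by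
    refine le_trans (Real.log_le_log (by positivity) ?_) (log_add_one_le_harmonic (n / r))
    rw [div_le_iff₀ hr0]
    have := Nat.lt_mul_div_succ n hr
    rw [mul_comm] at this
    exact_mod_cast this.le
  calc (n : ℝ) * Real.log (n / r) ≤ n * (harmonic (n / r) : ℝ) := by gcongr
    _ = ∑ j ∈ Finset.range (n / r), (n : ℝ) * ((j + 1 : ℕ) : ℝ)⁻¹ := by
        rw [harmonic, ← Finset.mul_sum]; push_cast; rfl
    _ ≤ ∑ j ∈ Finset.range (n / r), 2 * r * ((n / (j + 1) + 1 - r : ℕ) : ℝ) :=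
        Finset.sum_le_sum hterm
    _ = 2 * r * ((∑ j ∈ Finset.range (n / r), (n / (j + 1) + 1 - r) : ℕ) : ℝ) := by
        rw [Nat.cast_sum, Finset.mul_sum]
    _ ≤ _ := by
        gcongr

/-! ### Asymptotics in terms of `δ` -/

theorem scale_rpow_neg {α β δ : ℝ} (h0 : 0 < δ) : (δ ^ (-(1 / β))) ^ (-α) = δ ^ (α / β) := by
  rw [← Real.rpow_mul h0.le]; congr 1; ring

theorem mul_scale_rpow {α β δ : ℝ} (hβ : 0 < β) (h0 : 0 < δ) :
    δ * (δ ^ (-(1 / β))) ^ (β - α) = δ ^ (α / β) := by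
  rw [← Real.rpow_mul h0.le]
  nth_rw 1 [← Real.rpow_one δ]
  rw [← Real.rpow_add h0]; congr 1; field_simp; ring

theorem log_one_div_eq {β δ : ℝ} (hβ : 0 < β) (h0 : 0 < δ) :
    Real.log (1 / δ) = β * Real.log (δ ^ (-(1 / β))) := by
  rw [Real.log_rpow h0, one_div, Real.log_inv]; field_simp

theorem exists_le_scale {β : ℝ} (hβ : 0 < β) (B : ℝ) :
    ∃ δ₀ > (0 : ℝ), ∀ δ : ℝ, 0 < δ → δ < δ₀ → B ≤ δ ^ (-(1 / β)) := by
  -- the maximum with `2` makes the base of the power positive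
  refine ⟨(max B 2) ^ (-β), by positivity,
    fun δ h0 h1 => (le_max_left B 2).trans ?_⟩
  have h2 : ((max B 2) ^ (-β)) ^ (-(1 / β)) = max B 2 := by
    rw [← Real.rpow_mul (by positivity)]
    have : -β * -(1 / β) = 1 := by field_simp
    rw [this, Real.rpow_one]
  rw [← h2]
  exact Real.rpow_le_rpow_of_nonpos h0 h1.le (by rw [neg_nonpos]; positivity)

theorem exists_nat_between (r : ℕ) {b D : ℝ} (hb : 0 < b) (hD : (r + 1) / b ≤ D) :
    ∃ n : ℕ, r ≤ n ∧ b / 2 * D ≤ n ∧ n ≤ b * D := by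
  have h : (r : ℝ) + 1 ≤ b * D := by rwa [div_le_iff₀ hb, mul_comm] at hD
  have hr0 : (0 : ℝ) ≤ r := by positivity
  have h2 := Nat.floor_le (show 0 ≤ b * D by linarith)
  have h3 := Nat.lt_floor_add_one (b * D)
  have h1 : r + 1 ≤ ⌊b * D⌋₊ := Nat.le_floor (by push_cast; exact h)
  have h1' : (1 : ℝ) ≤ ⌊b * D⌋₊ := by exact_mod_cast (by omega : 1 ≤ ⌊b * D⌋₊)
  exact ⟨⌊b * D⌋₊, by omega, by linarith, h2⟩

theorem rpow_neg_le_of_le_mul {α c x y : ℝ} (hα : 0 ≤ α) (hc : 0 < c) (hx : 0 < x) (hy : 0 < y)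
    (h : x ≤ c * y) : y ^ (-α) ≤ c ^ α * x ^ (-α) := by
  have h1 : (c * y) ^ (-α) ≤ x ^ (-α) := Real.rpow_le_rpow_of_nonpos hx h (by linarith)
  rw [Real.mul_rpow hc.le hy.le, Real.rpow_neg hc.le, inv_mul_le_iff₀ (by positivity)] at h1
  exact h1

theorem rpow_neg_le_of_mul_le {α c x y : ℝ} (hα : 0 ≤ α) (hc : 0 < c) (hy : 0 < y)
    (h : c * y ≤ x) : x ^ (-α) ≤ c ^ (-α) * y ^ (-α) := by
  rw [← Real.mul_rpow hc.le hy.le]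
  exact Real.rpow_le_rpow_of_nonpos (by positivity) h (by linarith)

theorem minRadius_le_crossError {r : ℕ} (hr : 1 ≤ r) (s μ₁ μ₂ : ℝ) (p : ℝ≥0∞) (δ : ℝ) {n N : ℕ}
    {γ : ℝ} (hγ : 0 < γ) (h : (hyperbolicCross r n γ).card ≤ N) :
    minRadius r s μ₁ μ₂ p δ N ≤ crossError r s μ₁ μ₂ p δ n γ :=
  iInf₂_le_of_le (hyperbolicCross r n γ) ⟨fun _ hi => ((mem_hyperbolicCross hr hγ).mp hi).1, h⟩
    (iInf_le _ _)

/-- The zero algorithm without information. -/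
theorem minRadius_le_of_norm_partialDeriv_le {r : ℕ} {s μ₁ μ₂ C : ℝ}
    (h : ∀ f ∈ unitBall s μ₁ μ₂, ‖partialDeriv r f‖ ≤ C) (p : ℝ≥0∞) (δ : ℝ) (N : ℕ) :
    minRadius r s μ₁ μ₂ p δ N ≤ ENNReal.ofReal C :=
  iInf₂_le_of_le ∅ ⟨by simp, by simp⟩ (iInf_le_of_le (fun _ => 0)
    (algError_le_of_forall fun f hf a _ => by simpa using h f hf))

/-- For `n ≍ δ ^ (-1/β)` both parts of the error of the truncation method are of the order
`δ ^ (α/β)`. -/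
theorem crossError_le_of_between {r : ℕ} (hr : 1 ≤ r) {s μ₁ μ₂ α β γ : ℝ} (hs : 1 ≤ s) {p : ℝ≥0∞}
    (hp : 1 ≤ p) (hα : α = μ₁ - 2 * (r : ℝ) + 1 / s - 3 / 2) (hα0 : 0 < α)
    (hβ : β = μ₁ - (1 / p).toReal + 1 / s) (hμ : α < μ₂ + 1 / s - 3 / 2) (hγ1 : 1 ≤ γ)
    (hγ : γ * α < μ₂ + 1 / s - 3 / 2) :
    ∀ c₁ > (0 : ℝ), ∀ c₂ > (0 : ℝ), ∃ C > (0 : ℝ), ∀ δ : ℝ, 0 < δ → δ < 1 → ∀ n : ℕ, r ≤ n →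
      Between c₁ c₂ n (δ ^ (-(1 / β))) →
      crossError r s μ₁ μ₂ p δ n γ ≤ ENNReal.ofReal (C * δ ^ (α / β)) := by
  intro c₁ hc₁ c₂ hc₂
  obtain ⟨C, hC, h⟩ := crossError_le hr hs hp hα hα0 hβ hμ hγ1 hγ
  obtain ⟨-, hp1⟩ := toReal_one_div_mem hp
  have hαβ : 0 ≤ β - α := by
    have : (0 : ℝ) ≤ r := by positivity
    rw [hα, hβ]; linarith
  have hβ0 : 0 < β := by linarith
  refine ⟨C * (c₁ ^ (-α) + c₂ ^ (β - α)), by positivity, fun δ h0 h1 n hn ⟨hn1, hn2⟩ => ?_⟩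
  refine (h n (hr.trans hn) δ h0.le).trans (ENNReal.ofReal_le_ofReal ?_)
  set D := δ ^ (-(1 / β)) with hD
  have hD0 : 0 < D := by positivity
  have e1 : (n : ℝ) ^ (-α) ≤ c₁ ^ (-α) * δ ^ (α / β) := by
    rw [← scale_rpow_neg h0]
    exact rpow_neg_le_of_mul_le hα0.le hc₁ hD0 hn1
  have e2 : δ * (n : ℝ) ^ (β - α) ≤ c₂ ^ (β - α) * δ ^ (α / β) := by
    rw [← mul_scale_rpow hβ0 h0, ← hD]
    calc δ * (n : ℝ) ^ (β - α) ≤ δ * (c₂ * D) ^ (β - α) := by gcongr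
      _ = _ := by rw [Real.mul_rpow hc₂.le hD0.le]; ring
  rw [mul_assoc, add_mul]
  gcongr

/-- If `G n` is at most of the order `n`, then a small multiple of `δ ^ (-1/β)` is a choice of `n`
with `G n ≤ N`, for which an error of the order `δ ^ (α/β)` is of the order `N ^ (-α)`. -/
theorem exists_cross_card_le {r : ℕ} {α β : ℝ} (hα0 : 0 < α) (hβ0 : 0 < β) {G : ℕ → ℕ}
    {E : ℝ → ℕ → ℝ≥0∞}
    (hG : ∃ C > (0 : ℝ), ∀ n : ℕ, (G n : ℝ) ≤ C * n)
    (hE : ∀ c₁ > (0 : ℝ), ∀ c₂ > (0 : ℝ), ∃ C > (0 : ℝ), ∀ δ : ℝ, 0 < δ → δ < 1 → ∀ n : ℕ, r ≤ n →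
      Between c₁ c₂ n (δ ^ (-(1 / β))) → E δ n ≤ ENNReal.ofReal (C * δ ^ (α / β))) :
    ∀ c₁ > (0 : ℝ), ∀ c₂ > (0 : ℝ), ∃ δ₀ > (0 : ℝ), ∃ b₁ > (0 : ℝ), ∃ b₂ > (0 : ℝ),
      ∃ C > (0 : ℝ), ∀ δ : ℝ, 0 < δ → δ < 1 → δ < δ₀ → ∀ N : ℕ,
        Between c₁ c₂ N (δ ^ (-(1 / β))) →
        ∃ n : ℕ, r ≤ n ∧ Between b₁ b₂ n (δ ^ (-(1 / β))) ∧ G n ≤ N ∧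
          E δ n ≤ ENNReal.ofReal (C * (N : ℝ) ^ (-α)) := by
  intro c₁ hc₁ c₂ hc₂
  obtain ⟨C₀, hC₀, hG⟩ := hG
  have hb : 0 < c₁ / C₀ := by positivity
  obtain ⟨C, hC, hE⟩ := hE (c₁ / C₀ / 2) (by positivity) (c₁ / C₀) hb
  obtain ⟨δ₀, hδ₀, hscale⟩ := exists_le_scale hβ0 ((r + 1) / (c₁ / C₀))
  refine ⟨δ₀, hδ₀, c₁ / C₀ / 2, by positivity, c₁ / C₀, hb, C * c₂ ^ α, by positivity,
    fun δ h0 h1 h2 N ⟨hN1, hN2⟩ => ?_⟩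
  obtain ⟨n, hn, hn1, hn2⟩ := exists_nat_between r hb (hscale δ h0 h2)
  set D := δ ^ (-(1 / β)) with hD
  have hD0 : 0 < D := by positivity
  refine ⟨n, hn, ⟨hn1, hn2⟩, ?_, (hE δ h0 h1 n hn ⟨hn1, hn2⟩).trans (ENNReal.ofReal_le_ofReal ?_)⟩
  · have : (G n : ℝ) ≤ N := by
      calc (G n : ℝ) ≤ C₀ * n := hG n
        _ ≤ C₀ * (c₁ / C₀ * D) := by gcongr
        _ = c₁ * D := by field_simp
        _ ≤ N := hN1
    exact_mod_cast this
  · have hN0 : (0 : ℝ) < N := lt_of_lt_of_le (by positivity) hN1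
    rw [← scale_rpow_neg h0, mul_assoc]
    gcongr
    exact rpow_neg_le_of_le_mul hα0.le hc₂ hN0 hD0 hN2

/-- For small `δ` the logarithms of `n`, of `n/r` and of `1/δ` are comparable. -/
theorem card_hyperbolicCross_one_between {r : ℕ} (hr : 1 ≤ r) {β : ℝ} (hβ0 : 0 < β) :
    ∀ c₁ > (0 : ℝ), ∀ c₂ > (0 : ℝ), ∃ δ₀ > (0 : ℝ), ∃ C₁ > (0 : ℝ), ∃ C₂ > (0 : ℝ),
      ∀ δ : ℝ, 0 < δ → δ < 1 → δ < δ₀ → ∀ n : ℕ, r ≤ n → Between c₁ c₂ n (δ ^ (-(1 / β))) →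
        Between C₁ C₂ (hyperbolicCross r n 1).card (δ ^ (-(1 / β)) * Real.log (1 / δ)) := by
  intro c₁ hc₁ c₂ hc₂
  have hr0 : (0 : ℝ) < r := by exact_mod_cast hr
  obtain ⟨δ₀, hδ₀, hscale⟩ := exists_le_scale hβ0 (Real.exp 2 + c₂ + (r / c₁) ^ 2)
  refine ⟨δ₀, hδ₀, c₁ / (4 * r * β), by positivity, 6 * c₂ / β, by positivity,
    fun δ h0 h1 h2 n hn ⟨hn1, hn2⟩ => ?_⟩
  have hB := hscale δ h0 h2
  rw [log_one_div_eq hβ0 h0]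
  set D := δ ^ (-(1 / β)) with hD
  have hD0 : 0 < D := by positivity
  have hn0 : (0 : ℝ) < n := by exact_mod_cast hr.trans hn
  have hsq : 0 ≤ ((r : ℝ) / c₁) ^ 2 := by positivity
  have hlogD : 2 ≤ Real.log D := by
    rw [Real.le_log_iff_exp_le hD0]; linarith
  constructor
  · have hlog : Real.log D / 2 ≤ Real.log (n / r) := by
      rw [← Real.log_sqrt hD0.le]
      refine Real.log_le_log (by positivity) ?_
      rw [le_div_iff₀ hr0]
      have h3 : (r : ℝ) / c₁ ≤ Real.sqrt D := Real.le_sqrt_of_sq_le (by linarith [Real.exp_pos 2])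
      rw [div_le_iff₀ hc₁] at h3
      calc Real.sqrt D * r ≤ Real.sqrt D * (Real.sqrt D * c₁) := by gcongr
        _ = c₁ * (Real.sqrt D * Real.sqrt D) := by ring
        _ = c₁ * D := by rw [Real.mul_self_sqrt hD0.le]
        _ ≤ n := hn1
    have h4 : c₁ * D * (Real.log D / 2) ≤ 2 * r * (hyperbolicCross r n 1).card :=
      (mul_le_mul hn1 hlog (by linarith) hn0.le).trans (mul_log_le_card_hyperbolicCross_one hr hn)
    have h5 : c₁ / (4 * r * β) * (D * (β * Real.log D)) = c₁ * D * (Real.log D / 2) / (2 * r) := by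
      field_simp; ring
    rw [h5, div_le_iff₀ (by positivity)]
    linarith
  · have hlog : Real.log n ≤ 2 * Real.log D := by
      have : Real.log n ≤ Real.log (D * D) := by
        refine Real.log_le_log hn0 (hn2.trans ?_)
        gcongr
        linarith [Real.exp_pos 2]
      rw [Real.log_mul hD0.ne' hD0.ne'] at this
      linarith
    calc ((hyperbolicCross r n 1).card : ℝ) ≤ 2 * n * (2 + Real.log n) :=
          card_hyperbolicCross_one_le hr n
      _ ≤ 2 * (c₂ * D) * (3 * Real.log D) := by
          have : 0 ≤ Real.log n := Real.log_natCast_nonneg n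
          gcongr
          linarith
      _ = _ := by field_simp; ring

/-- The counterpart of `exists_cross_card_le` for `γ = 1`, where the number of points is of the
order `n ln n`. -/
theorem exists_cross_one_card_le {r : ℕ} (hr : 1 ≤ r) {α β : ℝ} (hα0 : 0 < α) (hβ0 : 0 < β)
    {E : ℝ → ℕ → ℝ≥0∞}
    (hE : ∀ c₁ > (0 : ℝ), ∀ c₂ > (0 : ℝ), ∃ C > (0 : ℝ), ∀ δ : ℝ, 0 < δ → δ < 1 → ∀ n : ℕ, r ≤ n →
      Between c₁ c₂ n (δ ^ (-(1 / β))) → E δ n ≤ ENNReal.ofReal (C * δ ^ (α / β))) :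
    ∀ c₁ > (0 : ℝ), ∀ c₂ > (0 : ℝ), ∃ δ₀ > (0 : ℝ), ∃ b₁ > (0 : ℝ), ∃ b₂ > (0 : ℝ),
      ∃ C > (0 : ℝ), ∀ δ : ℝ, 0 < δ → δ < 1 → δ < δ₀ → ∀ N : ℕ,
        Between c₁ c₂ N (δ ^ (-(1 / β)) * Real.log (1 / δ)) →
        ∃ n : ℕ, r ≤ n ∧ Between b₁ b₂ n (δ ^ (-(1 / β))) ∧ (hyperbolicCross r n 1).card ≤ N ∧
          E δ n ≤ ENNReal.ofReal (C * ((N : ℝ) / Real.log N) ^ (-α)) ∧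
          E δ n ≤ ENNReal.ofReal (C * δ ^ (α / β)) := by
  intro c₁ hc₁ c₂ hc₂
  -- `b ≤ 1` gives `ln n ≤ ln D` for `D = δ ^ (-1/β)`; `4 b ≤ c₁ β` then keeps the number of
  -- points, at most `4 b D ln D`, below `N`
  set b : ℝ := min 1 (c₁ * β / 4) with hb
  have hb0 : 0 < b := by positivity
  obtain ⟨C, hC, hE⟩ := hE (b / 2) (by positivity) b hb0
  obtain ⟨δ₀, hδ₀, hscale⟩ := exists_le_scale hβ0
    (Real.exp 2 + (1 / (c₁ * β)) ^ 2 + (r + 1) / b)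
  refine ⟨δ₀, hδ₀, b / 2, by positivity, b, hb0, C * (2 * c₂ * β) ^ α + C, by positivity,
    fun δ h0 h1 h2 N ⟨hN1, hN2⟩ => ?_⟩
  have hB := hscale δ h0 h2
  rw [log_one_div_eq hβ0 h0] at hN1 hN2
  have hsq : 0 ≤ (1 / (c₁ * β)) ^ 2 := by positivity
  have hrb : 0 ≤ ((r : ℝ) + 1) / b := by positivity
  have hexp := Real.exp_pos 2
  obtain ⟨n, hn, hn1, hn2⟩ := exists_nat_between r hb0 (D := δ ^ (-(1 / β))) (by linarith)
  have hEn := hE δ h0 h1 n hn ⟨hn1, hn2⟩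
  set D := δ ^ (-(1 / β)) with hD
  have hD0 : 0 < D := by positivity
  have hn0 : (0 : ℝ) < n := by exact_mod_cast hr.trans hn
  have hlogD : 2 ≤ Real.log D := by
    rw [Real.le_log_iff_exp_le hD0]; linarith
  have hpow : 0 ≤ δ ^ (α / β) := by positivity
  refine ⟨n, hn, ⟨hn1, hn2⟩, ?_, hEn.trans (ENNReal.ofReal_le_ofReal ?_),
    hEn.trans (ENNReal.ofReal_le_ofReal ?_)⟩
  · have hlog : Real.log n ≤ Real.log D := by
      refine Real.log_le_log hn0 (hn2.trans ?_)
      exact mul_le_of_le_one_left hD0.le (min_le_left _ _)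
    have hbβ : 4 * b ≤ c₁ * β := by linarith [min_le_right 1 (c₁ * β / 4)]
    have : ((hyperbolicCross r n 1).card : ℝ) ≤ N := by
      calc ((hyperbolicCross r n 1).card : ℝ) ≤ 2 * n * (2 + Real.log n) :=
            card_hyperbolicCross_one_le hr n
        _ ≤ 2 * (b * D) * (2 * Real.log D) := by
            have : 0 ≤ Real.log n := Real.log_natCast_nonneg n
            gcongr
            linarith
        _ = 4 * b * (D * Real.log D) := by ring
        _ ≤ c₁ * β * (D * Real.log D) := by
            have : 0 ≤ D * Real.log D := mul_nonneg hD0.le (by linarith)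
            gcongr
        _ = c₁ * (D * (β * Real.log D)) := by ring
        _ ≤ N := hN1
    exact_mod_cast this
  · -- `N ≥ √D` makes `ln N` at least half of `ln D`
    have hsqrt : Real.sqrt D ≤ N := by
      refine le_trans ?_ hN1
      have h3 : 1 / (c₁ * β) ≤ Real.sqrt D := Real.le_sqrt_of_sq_le (by linarith)
      rw [div_le_iff₀ (by positivity)] at h3
      calc Real.sqrt D = Real.sqrt D * 1 := (mul_one _).symm
        _ ≤ Real.sqrt D * (Real.sqrt D * (c₁ * β)) := by gcongr
        _ = c₁ * ((Real.sqrt D * Real.sqrt D) * (β * 1)) := by ring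
        _ = c₁ * (D * (β * 1)) := by rw [Real.mul_self_sqrt hD0.le]
        _ ≤ _ := by gcongr; linarith
    have hN0 : (0 : ℝ) < N := (Real.sqrt_pos.mpr hD0).trans_le hsqrt
    have hlogN : Real.log D / 2 ≤ Real.log N := by
      rw [← Real.log_sqrt hD0.le]
      exact Real.log_le_log (Real.sqrt_pos.mpr hD0) hsqrt
    have hlogN0 : 0 < Real.log N := by linarith
    have hND : (N : ℝ) / Real.log N ≤ 2 * c₂ * β * D := by
      rw [div_le_iff₀ hlogN0]
      calc (N : ℝ) ≤ c₂ * (D * (β * Real.log D)) := hN2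
        _ = 2 * c₂ * β * D * (Real.log D / 2) := by ring
        _ ≤ _ := by gcongr
    have h4 := rpow_neg_le_of_le_mul hα0.le (by positivity) (div_pos hN0 hlogN0) hD0 hND
    rw [scale_rpow_neg h0] at h4
    have h5 : 0 ≤ C * ((N : ℝ) / Real.log N) ^ (-α) := by positivity
    calc C * δ ^ (α / β) ≤ C * ((2 * c₂ * β) ^ α * ((N : ℝ) / Real.log N) ^ (-α)) := by gcongr
      _ ≤ _ := by rw [add_mul]; linarith
  · rw [add_mul]
    have : 0 ≤ C * (2 * c₂ * β) ^ α * δ ^ (α / β) := by positivity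
    linarith

/-! ### The orders of the minimal radius and of the truncation method -/

/-- The order of a radius `R` from its general lower bound, an upper bound for small `δ`, and its
boundedness, which is enough for the other `δ`, since `N` is bounded there. -/
theorem order_of_le_of_le {α β : ℝ} (hα0 : 0 < α) (hβ0 : 0 < β) {R : ℝ → ℕ → ℝ≥0∞}
    (hlow : ∃ c > (0 : ℝ), ∀ N : ℕ, 1 ≤ N → ∀ δ : ℝ, 0 ≤ δ →
      ENNReal.ofReal (c * (N : ℝ) ^ (-α)) ≤ R δ N)
    (hbdd : ∃ C > (0 : ℝ), ∀ δ N, R δ N ≤ ENNReal.ofReal C)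
    (hupp : ∀ c₁ > (0 : ℝ), ∀ c₂ > (0 : ℝ), ∃ δ₀ > (0 : ℝ), ∃ C > (0 : ℝ), ∀ δ : ℝ, 0 < δ → δ < 1 →
      δ < δ₀ → ∀ N : ℕ, Between c₁ c₂ N (δ ^ (-(1 / β))) →
      R δ N ≤ ENNReal.ofReal (C * (N : ℝ) ^ (-α))) :
    ∀ c₁ > (0 : ℝ), ∀ c₂ > (0 : ℝ), ∃ C₁ > (0 : ℝ), ∃ C₂ > (0 : ℝ),
      ∀ δ : ℝ, 0 < δ → δ < 1 → ∀ N : ℕ, Between c₁ c₂ N (δ ^ (-(1 / β))) →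
        EBetween C₁ C₂ (R δ N) ((N : ℝ) ^ (-α)) ∧ Between C₁ C₂ ((N : ℝ) ^ (-α)) (δ ^ (α / β)) := by
  intro c₁ hc₁ c₂ hc₂
  obtain ⟨c, hc, hlow⟩ := hlow
  obtain ⟨C₀, hC₀, hbdd⟩ := hbdd
  obtain ⟨δ₀, hδ₀, C, hC, hupp⟩ := hupp c₁ hc₁ c₂ hc₂
  set B := (c₂ * δ₀ ^ (-(1 / β))) with hB
  have hB0 : 0 < B := by positivity
  refine ⟨min c (c₂ ^ α)⁻¹, by positivity, C + C₀ * B ^ α + c₁ ^ (-α), by positivity,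
    fun δ h0 h1 N hN => ?_⟩
  obtain ⟨hN1, hN2⟩ := hN
  have hD0 : 0 < δ ^ (-(1 / β)) := by positivity
  have hN0 : (0 : ℝ) < N := lt_of_lt_of_le (by positivity) hN1
  have hNα : 0 < (N : ℝ) ^ (-α) := by positivity
  have hBα : 0 < B ^ α := by positivity
  have hcα : 0 < c₁ ^ (-α) := by positivity
  refine ⟨⟨?_, ?_⟩, ?_, ?_⟩
  · refine le_trans (ENNReal.ofReal_le_ofReal ?_) (hlow N (by exact_mod_cast hN0) δ h0.le)
    gcongr
    exact min_le_left _ _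
  · rcases lt_or_ge δ δ₀ with hδ | hδ
    · refine (hupp δ h0 h1 hδ N ⟨hN1, hN2⟩).trans (ENNReal.ofReal_le_ofReal ?_)
      gcongr
      have := mul_pos hC₀ hBα
      linarith
    · refine (hbdd δ N).trans (ENNReal.ofReal_le_ofReal ?_)
      have hNB : (N : ℝ) ≤ B * 1 := by
        rw [mul_one]
        refine hN2.trans (mul_le_mul_of_nonneg_left ?_ hc₂.le)
        exact Real.rpow_le_rpow_of_nonpos hδ₀ hδ (by rw [neg_nonpos]; positivity)
      have h2 := rpow_neg_le_of_le_mul hα0.le hB0 hN0 one_pos hNB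
      rw [Real.one_rpow] at h2
      have h3 : C₀ * 1 ≤ C₀ * (B ^ α * (N : ℝ) ^ (-α)) := by gcongr
      nlinarith [mul_pos hC hNα, mul_pos hcα hNα]
  · have h2 := rpow_neg_le_of_le_mul hα0.le hc₂ hN0 hD0 hN2
    rw [scale_rpow_neg h0] at h2
    calc min c (c₂ ^ α)⁻¹ * δ ^ (α / β) ≤ (c₂ ^ α)⁻¹ * δ ^ (α / β) := by
          gcongr
          exact min_le_right _ _
      _ ≤ _ := by rwa [inv_mul_le_iff₀ (by positivity)]
  · have h2 := rpow_neg_le_of_mul_le hα0.le hc₁ hD0 hN1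
    rw [scale_rpow_neg h0] at h2
    refine h2.trans ?_
    gcongr
    have := mul_pos hC₀ hBα
    linarith

/-- The counterpart of `order_of_le_of_le` for `N ≍ δ ^ (-1/β) ln (1/δ)`. -/
theorem order_log_of_le_of_le {α β : ℝ} (hα0 : 0 < α) (hβ0 : 0 < β) {R : ℝ → ℕ → ℝ≥0∞}
    (hlow : ∃ c > (0 : ℝ), ∀ N : ℕ, 1 ≤ N → ∀ δ : ℝ, 0 ≤ δ →
      ENNReal.ofReal (c * (N : ℝ) ^ (-α)) ≤ R δ N)
    (hbdd : ∃ C > (0 : ℝ), ∀ δ N, R δ N ≤ ENNReal.ofReal C)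
    (hupp : ∀ c₁ > (0 : ℝ), ∀ c₂ > (0 : ℝ), ∃ δ₀ > (0 : ℝ), ∃ C > (0 : ℝ), ∀ δ : ℝ, 0 < δ → δ < 1 →
      δ < δ₀ → ∀ N : ℕ, Between c₁ c₂ N (δ ^ (-(1 / β)) * Real.log (1 / δ)) →
      R δ N ≤ ENNReal.ofReal (C * ((N : ℝ) / Real.log N) ^ (-α)) ∧
      R δ N ≤ ENNReal.ofReal (C * δ ^ (α / β))) :
    ∀ c₁ > (0 : ℝ), ∀ c₂ > (0 : ℝ), ∃ C₁ > (0 : ℝ), ∃ C₂ > (0 : ℝ),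
      ∀ δ : ℝ, 0 < δ → δ < 1 → ∀ N : ℕ,
        Between c₁ c₂ N (δ ^ (-(1 / β)) * Real.log (1 / δ)) →
        ENNReal.ofReal (C₁ * (N : ℝ) ^ (-α)) ≤ R δ N ∧
        (2 ≤ N → R δ N ≤ ENNReal.ofReal (C₂ * ((N : ℝ) / Real.log N) ^ (-α))) ∧
        ENNReal.ofReal (C₁ * (δ ^ (α / β) * Real.log (1 / δ) ^ (-α))) ≤ R δ N ∧
        R δ N ≤ ENNReal.ofReal (C₂ * δ ^ (α / β)) := by
  intro c₁ hc₁ c₂ hc₂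
  obtain ⟨c, hc, hlow⟩ := hlow
  obtain ⟨C₀, hC₀, hbdd⟩ := hbdd
  obtain ⟨δ₁, hδ₁, C, hC, hupp⟩ := hupp c₁ hc₁ c₂ hc₂
  -- a threshold below `1`, so that `ln (1/δ₀)` is positive
  obtain ⟨δ₀, hδ₀, hδ₀1, hδ₀2⟩ : ∃ δ₀ : ℝ, 0 < δ₀ ∧ δ₀ < 1 ∧ δ₀ ≤ δ₁ :=
    ⟨min δ₁ (1 / 2), by positivity, (min_le_right _ _).trans_lt (by norm_num), min_le_left _ _⟩
  have hL0 : 0 < Real.log (1 / δ₀) :=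
    Real.log_pos (by rw [one_div]; exact (one_lt_inv₀ hδ₀).mpr hδ₀1)
  set B := c₂ * (δ₀ ^ (-(1 / β)) * Real.log (1 / δ₀)) / Real.log 2 with hB
  have hlog2 : 0 < Real.log 2 := Real.log_pos one_lt_two
  have hB0 : 0 < B := by positivity
  have hBα : 0 < B ^ α := by positivity
  have hδα : 0 < δ₀ ^ (-(α / β)) := by positivity
  refine ⟨min c (c * (c₂ ^ α)⁻¹), by positivity, C + C₀ * B ^ α + C₀ * δ₀ ^ (-(α / β)),
    by positivity, fun δ h0 h1 N hN => ?_⟩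
  obtain ⟨hN1, hN2⟩ := hN
  have hD0 : 0 < δ ^ (-(1 / β)) := by positivity
  have hL : 0 < Real.log (1 / δ) := Real.log_pos (by rw [one_div]; exact one_lt_inv₀ h0 |>.mpr h1)
  have hN0 : (0 : ℝ) < N := lt_of_lt_of_le (by positivity) hN1
  have hNα : 0 < (N : ℝ) ^ (-α) := by positivity
  have hδ0 : 0 < δ ^ (α / β) := by positivity
  have hCB := mul_pos hC₀ hBα
  have hCδ := mul_pos hC₀ hδα
  have hlowN := hlow N (by exact_mod_cast hN0) δ h0.le
  refine ⟨?_, fun hN2' => ?_, ?_, ?_⟩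
  · refine le_trans (ENNReal.ofReal_le_ofReal ?_) hlowN
    gcongr
    exact min_le_left _ _
  · have h2N : (2 : ℝ) ≤ N := by exact_mod_cast hN2'
    have hlogN : Real.log 2 ≤ Real.log N := Real.log_le_log two_pos h2N
    have hq : 0 < (N : ℝ) / Real.log N := by have := hlog2.trans_le hlogN; positivity
    have hqα : 0 < ((N : ℝ) / Real.log N) ^ (-α) := by positivity
    rcases lt_or_ge δ δ₀ with hδ | hδ
    · refine (hupp δ h0 h1 (hδ.trans_le hδ₀2) N ⟨hN1, hN2⟩).1.trans (ENNReal.ofReal_le_ofReal ?_)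
      gcongr
      linarith
    · refine (hbdd δ N).trans (ENNReal.ofReal_le_ofReal ?_)
      have hNB : (N : ℝ) / Real.log N ≤ B * 1 := by
        rw [mul_one, hB]
        refine div_le_div₀ (by positivity) (hN2.trans (mul_le_mul_of_nonneg_left ?_ hc₂.le)) hlog2
          hlogN
        refine mul_le_mul ?_ ?_ hL.le (by positivity)
        · exact Real.rpow_le_rpow_of_nonpos hδ₀ hδ (by rw [neg_nonpos]; positivity)
        · exact Real.log_le_log (by positivity) (one_div_le_one_div_of_le hδ₀ hδ)
      have h2 := rpow_neg_le_of_le_mul hα0.le hB0 hq one_pos hNB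
      rw [Real.one_rpow] at h2
      have h3 : C₀ * 1 ≤ C₀ * (B ^ α * ((N : ℝ) / Real.log N) ^ (-α)) := by gcongr
      nlinarith [mul_pos hC hqα, mul_pos hCδ hqα]
  · refine le_trans (ENNReal.ofReal_le_ofReal ?_) hlowN
    have h2 := rpow_neg_le_of_le_mul hα0.le hc₂ hN0 (mul_pos hD0 hL) hN2
    rw [Real.mul_rpow hD0.le hL.le, scale_rpow_neg h0] at h2
    calc _ ≤ c * (c₂ ^ α)⁻¹ * (δ ^ (α / β) * Real.log (1 / δ) ^ (-α)) := by
          gcongr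
          exact min_le_right _ _
      _ ≤ _ := by
          rw [mul_assoc]
          gcongr
          rwa [inv_mul_le_iff₀ (by positivity)]
  · rcases lt_or_ge δ δ₀ with hδ | hδ
    · refine (hupp δ h0 h1 (hδ.trans_le hδ₀2) N ⟨hN1, hN2⟩).2.trans (ENNReal.ofReal_le_ofReal ?_)
      gcongr
      linarith
    · refine (hbdd δ N).trans (ENNReal.ofReal_le_ofReal ?_)
      have h2 : 1 ≤ δ₀ ^ (-(α / β)) * δ ^ (α / β) := by
        rw [Real.rpow_neg hδ₀.le, ← div_eq_inv_mul, one_le_div (by positivity)]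
        gcongr
      have h3 : C₀ * 1 ≤ C₀ * (δ₀ ^ (-(α / β)) * δ ^ (α / β)) := by gcongr
      nlinarith [mul_pos hC hδ0, mul_pos hCB hδ0]

end GalerkinRadius

theorem mainTheorem1 (r : ℕ) (hr : 1 ≤ r) (s μ₁ μ₂ : ℝ) (hs : 1 ≤ s) (p : ENNReal) (hp : 1 ≤ p)
    (hμ₁ : 2 * (r : ℝ) - 1 / s + 3 / 2 < μ₁) (hμ₂ : μ₁ - 2 * (r : ℝ) < μ₂)
    (α β : ℝ) (hα : α = μ₁ - 2 * (r : ℝ) + 1 / s - 3 / 2)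
    (hβ : β = μ₁ - (1 / p).toReal + 1 / s) :
    -- the series that defines `f^{(r,0)}` converges in `C(Q)`
    (∀ f ∈ GalerkinRadius.unitBall s μ₁ μ₂, Summable (GalerkinRadius.derivTerm r f)) ∧
    -- (a) the order of the minimal radius
    (∀ c₁ > (0 : ℝ), ∀ c₂ > (0 : ℝ), ∃ C₁ > (0 : ℝ), ∃ C₂ > (0 : ℝ),
      ∀ δ : ℝ, 0 < δ → δ < 1 → ∀ N : ℕ,
        GalerkinRadius.Between c₁ c₂ N (δ ^ (-(1 / β))) →
        GalerkinRadius.EBetween C₁ C₂ (GalerkinRadius.minRadius r s μ₁ μ₂ p δ N)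
          ((N : ℝ) ^ (-α)) ∧
        GalerkinRadius.Between C₁ C₂ ((N : ℝ) ^ (-α)) (δ ^ (α / β))) ∧
    -- (a) the method with `1 < γ < (μ₂ + 1/s - 3/2) / (μ₁ - 2r + 1/s - 3/2)`
    (∀ γ : ℝ, 1 < γ → γ < (μ₂ + 1 / s - 3 / 2) / α →
      (∀ c₁ > (0 : ℝ), ∀ c₂ > (0 : ℝ), ∃ C₁ > (0 : ℝ), ∃ C₂ > (0 : ℝ),
        ∀ δ : ℝ, 0 < δ → δ < 1 → ∀ n : ℕ, r ≤ n →
          GalerkinRadius.Between c₁ c₂ n (δ ^ (-(1 / β))) →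
          GalerkinRadius.Between C₁ C₂ (GalerkinRadius.hyperbolicCross r n γ).card
            (δ ^ (-(1 / β))) ∧
          GalerkinRadius.EBetween C₁ C₂ (GalerkinRadius.crossError r s μ₁ μ₂ p δ n γ)
            (δ ^ (α / β))) ∧
      (∀ c₁ > (0 : ℝ), ∀ c₂ > (0 : ℝ), ∃ δ₀ > (0 : ℝ), ∃ b₁ > (0 : ℝ), ∃ b₂ > (0 : ℝ),
        ∃ C > (0 : ℝ), ∀ δ : ℝ, 0 < δ → δ < 1 → δ < δ₀ → ∀ N : ℕ,
          GalerkinRadius.Between c₁ c₂ N (δ ^ (-(1 / β))) →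
          ∃ n : ℕ, r ≤ n ∧ GalerkinRadius.Between b₁ b₂ n (δ ^ (-(1 / β))) ∧
            (GalerkinRadius.hyperbolicCross r n γ).card ≤ N ∧
            GalerkinRadius.crossError r s μ₁ μ₂ p δ n γ ≤ ENNReal.ofReal (C * (N : ℝ) ^ (-α)))) ∧
    -- (b) the bounds for the minimal radius
    (∀ c₁ > (0 : ℝ), ∀ c₂ > (0 : ℝ), ∃ C₁ > (0 : ℝ), ∃ C₂ > (0 : ℝ),
      ∀ δ : ℝ, 0 < δ → δ < 1 → ∀ N : ℕ,
        GalerkinRadius.Between c₁ c₂ N (δ ^ (-(1 / β)) * Real.log (1 / δ)) →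
        ENNReal.ofReal (C₁ * (N : ℝ) ^ (-α)) ≤ GalerkinRadius.minRadius r s μ₁ μ₂ p δ N ∧
        (2 ≤ N → GalerkinRadius.minRadius r s μ₁ μ₂ p δ N ≤
          ENNReal.ofReal (C₂ * ((N : ℝ) / Real.log N) ^ (-α))) ∧
        ENNReal.ofReal (C₁ * (δ ^ (α / β) * Real.log (1 / δ) ^ (-α))) ≤
          GalerkinRadius.minRadius r s μ₁ μ₂ p δ N ∧
        GalerkinRadius.minRadius r s μ₁ μ₂ p δ N ≤ ENNReal.ofReal (C₂ * δ ^ (α / β))) ∧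
    -- (b) the method with `γ = 1`
    (∀ c₁ > (0 : ℝ), ∀ c₂ > (0 : ℝ), ∃ δ₀ > (0 : ℝ), ∃ C₁ > (0 : ℝ), ∃ C₂ > (0 : ℝ),
      ∀ δ : ℝ, 0 < δ → δ < 1 → ∀ n : ℕ, r ≤ n →
        GalerkinRadius.Between c₁ c₂ n (δ ^ (-(1 / β))) →
        (δ < δ₀ → GalerkinRadius.Between C₁ C₂ (GalerkinRadius.hyperbolicCross r n 1).card
          (δ ^ (-(1 / β)) * Real.log (1 / δ))) ∧
        GalerkinRadius.crossError r s μ₁ μ₂ p δ n 1 ≤ ENNReal.ofReal (C₂ * δ ^ (α / β))) ∧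
    (∀ c₁ > (0 : ℝ), ∀ c₂ > (0 : ℝ), ∃ δ₀ > (0 : ℝ), ∃ b₁ > (0 : ℝ), ∃ b₂ > (0 : ℝ),
      ∃ C > (0 : ℝ), ∀ δ : ℝ, 0 < δ → δ < 1 → δ < δ₀ → ∀ N : ℕ,
        GalerkinRadius.Between c₁ c₂ N (δ ^ (-(1 / β)) * Real.log (1 / δ)) →
        ∃ n : ℕ, r ≤ n ∧ GalerkinRadius.Between b₁ b₂ n (δ ^ (-(1 / β))) ∧
          (GalerkinRadius.hyperbolicCross r n 1).card ≤ N ∧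
          GalerkinRadius.crossError r s μ₁ μ₂ p δ n 1 ≤
            ENNReal.ofReal (C * ((N : ℝ) / Real.log N) ^ (-α)) ∧
          GalerkinRadius.crossError r s μ₁ μ₂ p δ n 1 ≤ ENNReal.ofReal (C * δ ^ (α / β))) := by
  have hr1 : (1 : ℝ) ≤ r := by exact_mod_cast hr
  have hs1 : 1 / s ≤ 1 := by rw [div_le_one (by linarith)]; exact hs
  have hs0 : 0 < 1 / s := by positivity
  obtain ⟨-, hp1⟩ := GalerkinRadius.toReal_one_div_mem hp
  have hα0 : 0 < α := by rw [hα]; linarith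
  have hβ0 : 0 < β := by rw [hβ]; linarith
  have hμ : α < μ₂ + 1 / s - 3 / 2 := by rw [hα]; linarith
  obtain ⟨C₀, hC₀, hser⟩ := GalerkinRadius.summable_and_norm_partialDeriv_le r hs hα hα0 hμ
  have hbdd : ∃ C > (0 : ℝ), ∀ (δ : ℝ) (N : ℕ),
      GalerkinRadius.minRadius r s μ₁ μ₂ p δ N ≤ ENNReal.ofReal C :=
    ⟨C₀, hC₀, fun δ N =>
      GalerkinRadius.minRadius_le_of_norm_partialDeriv_le (fun f hf => (hser f hf).2) p δ N⟩
  have hlow : ∃ c > (0 : ℝ), ∀ N : ℕ, 1 ≤ N → ∀ δ : ℝ, 0 ≤ δ →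
      ENNReal.ofReal (c * (N : ℝ) ^ (-α)) ≤ GalerkinRadius.minRadius r s μ₁ μ₂ p δ N :=
    GalerkinRadius.le_minRadius hr hs p hα (by linarith)
  have hE1 := GalerkinRadius.crossError_le_of_between hr hs hp hα hα0 hβ hμ le_rfl (by linarith)
  have hE : ∀ γ : ℝ, 1 < γ → γ < (μ₂ + 1 / s - 3 / 2) / α → _ := fun γ h1 h2 =>
    GalerkinRadius.crossError_le_of_between hr hs hp hα hα0 hβ hμ h1.le ((lt_div_iff₀ hα0).mp h2)
  have hmeth := fun γ (h1 : 1 < γ) (h2 : γ < (μ₂ + 1 / s - 3 / 2) / α) =>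
    GalerkinRadius.exists_cross_card_le hα0 hβ0 (GalerkinRadius.card_hyperbolicCross_le hr h1)
      (E := fun δ n => GalerkinRadius.crossError r s μ₁ μ₂ p δ n γ) (hE γ h1 h2)
  have hmeth1 := GalerkinRadius.exists_cross_one_card_le hr hα0 hβ0
    (E := fun δ n => GalerkinRadius.crossError r s μ₁ μ₂ p δ n 1) hE1
  refine ⟨fun f hf => (hser f hf).1, ?_, fun γ hγ1 hγ2 => ⟨?_, hmeth γ hγ1 hγ2⟩, ?_, ?_, hmeth1⟩
  · obtain ⟨γ, hγ1, hγ2⟩ := exists_between ((one_lt_div hα0).mpr hμ)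
    refine GalerkinRadius.order_of_le_of_le hα0 hβ0 hlow hbdd fun c₁ hc₁ c₂ hc₂ => ?_
    obtain ⟨δ₀, hδ₀, _, _, _, _, C, hC, h⟩ := hmeth γ hγ1 hγ2 c₁ hc₁ c₂ hc₂
    refine ⟨δ₀, hδ₀, C, hC, fun δ h0 h1 h2 N hN => ?_⟩
    obtain ⟨n, -, -, hcard, herr⟩ := h δ h0 h1 h2 N hN
    exact (GalerkinRadius.minRadius_le_crossError hr s μ₁ μ₂ p δ (by linarith) hcard).trans herr
  · intro c₁ hc₁ c₂ hc₂
    obtain ⟨C, hC, hG⟩ := GalerkinRadius.card_hyperbolicCross_le hr hγ1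
    obtain ⟨C', hC', hEγ⟩ := hE γ hγ1 hγ2 c₁ hc₁ c₂ hc₂
    obtain ⟨c, hc, hlow⟩ := hlow
    have hr0 : (0 : ℝ) < r := by linarith
    refine ⟨min (c₁ / r) (c * ((C * c₂) ^ α)⁻¹), by positivity, C * c₂ + C', by positivity,
      fun δ h0 h1 n hn hN => ?_⟩
    have hEn := hEγ δ h0 h1 n hn hN
    obtain ⟨hN1, hN2⟩ := hN
    have hD0 : 0 < δ ^ (-(1 / β)) := by positivity
    have hpow : 0 < δ ^ (α / β) := by positivity
    have hn0 : (0 : ℝ) < n := by exact_mod_cast hr.trans hn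
    have hlo : (n : ℝ) ≤ r * (GalerkinRadius.hyperbolicCross r n γ).card := by
      exact_mod_cast GalerkinRadius.le_mul_card_hyperbolicCross hr hn (by linarith)
    have hhi : ((GalerkinRadius.hyperbolicCross r n γ).card : ℝ) ≤ C * c₂ * δ ^ (-(1 / β)) := by
      rw [mul_assoc]
      exact (hG n).trans (by gcongr)
    have hcard0 : (0 : ℝ) < (GalerkinRadius.hyperbolicCross r n γ).card :=
      pos_of_mul_pos_right (hn0.trans_le hlo) hr0.le
    refine ⟨⟨?_, ?_⟩, ?_, ?_⟩
    · calc _ ≤ c₁ / r * δ ^ (-(1 / β)) := by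
            gcongr
            exact min_le_left _ _
        _ = c₁ * δ ^ (-(1 / β)) / r := by ring
        _ ≤ _ := by
            rw [div_le_iff₀' hr0]
            exact hN1.trans hlo
    · refine hhi.trans ?_
      gcongr
      linarith
    · -- the cross itself is admissible information with as many indices as it has points
      refine le_trans (ENNReal.ofReal_le_ofReal ?_)
        ((hlow _ (by exact_mod_cast hcard0) δ h0.le).trans
          (GalerkinRadius.minRadius_le_crossError hr s μ₁ μ₂ p δ (by linarith) le_rfl))
      have h2 := GalerkinRadius.rpow_neg_le_of_le_mul hα0.le (by positivity) hcard0 hD0 hhi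
      rw [GalerkinRadius.scale_rpow_neg h0] at h2
      calc _ ≤ c * ((C * c₂) ^ α)⁻¹ * δ ^ (α / β) := by
            gcongr
            exact min_le_right _ _
        _ ≤ _ := by
            rw [mul_assoc]
            gcongr
            rwa [inv_mul_le_iff₀ (by positivity)]
    · refine hEn.trans (ENNReal.ofReal_le_ofReal ?_)
      gcongr
      have : 0 < C * c₂ := by positivity
      linarith
  · refine GalerkinRadius.order_log_of_le_of_le hα0 hβ0 hlow hbdd fun c₁ hc₁ c₂ hc₂ => ?_
    obtain ⟨δ₀, hδ₀, _, _, _, _, C, hC, h⟩ := hmeth1 c₁ hc₁ c₂ hc₂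
    refine ⟨δ₀, hδ₀, C, hC, fun δ h0 h1 h2 N hN => ?_⟩
    obtain ⟨n, -, -, hcard, herr1, herr2⟩ := h δ h0 h1 h2 N hN
    have := GalerkinRadius.minRadius_le_crossError hr s μ₁ μ₂ p δ one_pos hcard
    exact ⟨this.trans herr1, this.trans herr2⟩
  · intro c₁ hc₁ c₂ hc₂
    obtain ⟨δ₀, hδ₀, C₁, hC₁, C₂, hC₂, hG⟩ :=
      GalerkinRadius.card_hyperbolicCross_one_between hr hβ0 c₁ hc₁ c₂ hc₂
    obtain ⟨C, hC, hEn⟩ := hE1 c₁ hc₁ c₂ hc₂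
    refine ⟨δ₀, hδ₀, C₁, hC₁, C₂ + C, by positivity, fun δ h0 h1 n hn hN => ⟨fun h2 => ?_, ?_⟩⟩
    · obtain ⟨hlo, hhi⟩ := hG δ h0 h1 h2 n hn hN
      have hL : 0 ≤ Real.log (1 / δ) :=
        Real.log_nonneg (by rw [one_div]; exact (one_le_inv₀ h0).mpr h1.le)
      refine ⟨hlo, hhi.trans ?_⟩
      gcongr
      linarith
    · refine (hEn δ h0 h1 n hn hN).trans (ENNReal.ofReal_le_ofReal ?_)
      gcongr
      linarith
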